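/- **Programs.** Let $\mathsf{Var}$ be a countably infinite set of variables (identified with $\mathbb N$). Arithmetical expressions $e$ are built from variables and constants in $\mathbb Q_{\ge 0}$ by $+,-,\cdot$; Boolean expressions $b$ are built from comparisons $e_1=e_2$, $e_1<e_2$ by negation and conjunction. The set $\mathsf{Prog}$ of fully probabilistic programs is given by the grammar $$P ::= v := e \;\mid\; P;P \;\mid\; \{P\}\,[p]\,\{P\} \;\mid\; \mathtt{WHILE}\,(b)\,\{P\},\qquad v\in\mathsf{Var},\ p\in[0,1]\cap\mathbb Q .$$ A valuation is a map $\eta:\mathsf{Var}\to\mathbb Q_{\ge 0}$; expressions are evaluated in $\mathbb Q$, giving $[\![e]\!]_\eta$ and $[\![b]\!]_\eta$. **Semantics.** A state is a tuple $\langle C,\eta,a,\theta\rangle$, where the control $C$ is the terminated program $\downarrow$, a program, or a residual $C';Q$ of a started concatenation, $\eta$ is a valuation, $a\in\mathbb Q_{\ge 0}$ is the probability of the choices made so far, and $\theta\in\{L,R\}^*$ is the sequence of these choices. The relation $\vdash$ is the smallest one with - $\langle v:=e,\eta,a,\theta\rangle\vdash\langle\downarrow,\eta[v\mapsto\max\{[\![e]\!]_\eta,0\}],a,\theta\rangle$;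 - $\langle C;Q,\eta,a,\theta\rangle\vdash\langle C';Q,\eta',a',\theta'\rangle$ whenever $\langle C,\eta,a,\theta\rangle\vdash\langle C',\eta',a',\theta'\rangle$; - $\langle \downarrow;Q,\eta,a,\theta\rangle\vdash\langle Q,\eta,a,\theta\rangle$; - $\langle\{P\}[p]\{Q\},\eta,a,\theta\rangle\vdash\langle P,\eta,a\cdot p,\theta L\rangle$ and $\langle\{P\}[p]\{Q\},\eta,a,\theta\rangle\vdash\langle Q,\eta,a\cdot(1-p),\theta R\rangle$; - $\langle\mathtt{WHILE}(b)\{P\},\eta,a,\theta\rangle\vdash\langle P;\mathtt{WHILE}(b)\{P\},\eta,a,\theta\rangle$ if $[\![b]\!]_\eta$ is true, and $\vdash\langle\downarrow,\eta,a,\theta\rangle$ if it is false. For a state $\sigma$, $k\in\mathbb N$ and $w\in\{L,R\}^*$ let $T_k(\sigma,w)$ be the unique state reached from $\sigma$ in exactly $k$ steps during which exactly the choices $w$ are made, in this order, and $\bot$ if there is no such state. Let $\alpha(\langle\downarrow,\eta,a,\theta\rangle)=a$ and $\alpha=0$ on all other states and on $\bot$. The probability that $P$ terminates on $\eta$ is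 $$\Pr_{P,\eta}(\downarrow)=\sum_{k=0}^{\infty}\ \sum_{w\in\{L,R\}^{\le k}}\alpha\big(T_k(\langle P,\eta,1,\varepsilon\rangle,w)\big).$$ **The problem.** An input is a valuation $\eta$ with $\eta(v)\neq 0$ for only finitely many $v$. Let $\mathcal{AST}$ be the set of all pairs $(P,\eta)$ of a program $P\in\mathsf{Prog}$ and an input $\eta$ with $\Pr_{P,\eta}(\downarrow)=1$. Programs and inputs are coded effectively by natural numbers in the usual way. A set $A$ of effectively coded objects is in $\Pi^0_2$ if there is a decidable relation $R$ with $A=\{x\mid \forall y_1\in\mathbb N\ \exists y_2\in\mathbb N:\ (x,y_1,y_2)\in R\}$. It is $\Pi^0_2$-complete if it is in $\Pi^0_2$ and every $C\in\Pi^0_2$ is many-one reducible to it, i.e. there is a computable function $f$ with $x\in C\Leftrightarrow f(x)\in A$ for all $x$. **Theorem.** $\mathcal{AST}$ is $\Pi^0_2$-complete. -/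

import Mathlib

open scoped NNRat NNReal ENNReal

/-! ## Second level of the arithmetical hierarchy -/

/-- `A` is a `Π₂⁰` set: `A = {x | ∀ y₁, ∃ y₂, R (x, y₁, y₂)}` for a decidable relation `R`. -/
def IsPi2 {α : Type} [Primcodable α] (A : Set α) : Prop :=
  ∃ R : α × ℕ × ℕ → Prop, ComputablePred R ∧ ∀ x, x ∈ A ↔ ∀ y₁, ∃ y₂, R (x, y₁, y₂)

/-- `A` is `Π₂⁰`-complete: it is `Π₂⁰`, and every `Π₂⁰` set (over any effectively coded universe)
is many-one reducible to it. -/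
structure IsPi2Complete {α : Type} [Primcodable α] (A : Set α) : Prop where
  mem : IsPi2 A
  hard : ∀ (β : Type) [Primcodable β] (C : Set β), IsPi2 C → (· ∈ C) ≤₀ (· ∈ A)

namespace PGCL

/-! ## Syntax -/

/-- Program variables. -/
abbrev Var := ℕ

/-- Variable valuations. -/
abbrev Valuation := Var → ℚ≥0

/-- Arithmetical expressions. -/
inductive AExp
  | const (q : ℚ≥0)
  | var (v : Var)
  | add (e₁ e₂ : AExp)
  | sub (e₁ e₂ : AExp)
  | mul (e₁ e₂ : AExp)

/-- Boolean expressions over arithmetical expressions. -/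
inductive BExp
  | eq (e₁ e₂ : AExp)
  | lt (e₁ e₂ : AExp)
  | not (b : BExp)
  | and (b₁ b₂ : BExp)

/-- Rational probabilities. -/
abbrev Prob := {q : ℚ≥0 // q ≤ 1}

/-- Fully probabilistic programs: `v := e`, `P; Q`, `{P} [p] {Q}`, and `WHILE (b) {P}`. -/
inductive Prog
  | assign (v : Var) (e : AExp)
  | seq (P Q : Prog)
  | choice (p : Prob) (P Q : Prog)
  | loop (b : BExp) (P : Prog)

/-! ## Semantics -/

/-- Evaluation of arithmetical expressions; intermediate results may be negative. -/
def AExp.eval (η : Valuation) : AExp → ℚ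
  | .const q => (q : ℚ)
  | .var v => (η v : ℚ)
  | .add e₁ e₂ => e₁.eval η + e₂.eval η
  | .sub e₁ e₂ => e₁.eval η - e₂.eval η
  | .mul e₁ e₂ => e₁.eval η * e₂.eval η

/-- Evaluation of Boolean expressions. -/
def BExp.eval (η : Valuation) : BExp → Bool
  | .eq e₁ e₂ => decide (e₁.eval η = e₂.eval η)
  | .lt e₁ e₂ => decide (e₁.eval η < e₂.eval η)
  | .not b => !b.eval η
  | .and b₁ b₂ => b₁.eval η && b₂.eval η

/-- The control component of a state: the terminated program `↓`, a program, or a residual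
`C; P` in which `C` has already been started (so that `C` may be `↓`). -/
inductive Ctrl
  | down
  | prog (P : Prog)
  | seq (C : Ctrl) (P : Prog)

/-- The two outcomes of a probabilistic choice: `true` is `L`(eft), `false` is `R`(ight). -/
abbrev Dir := Bool

/-- The left branch. -/
abbrev Dir.L : Dir := true

/-- The right branch. -/
abbrev Dir.R : Dir := false

/-- Program states: control, current valuation, probability of the choices made so far, and the
sequence of these choices. -/
structure State where
  ctrl : Ctrl
  val : Valuation
  prob : ℚ≥0
  trace : List Dir

/-- The small-step relation `⊢`. The rule for started concatenations occurs twice, once for a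
program `P; Q` and once for a residual `C; Q`. -/
inductive Step : State → State → Prop
  | assign (v e η a θ) :
      Step ⟨.prog (.assign v e), η, a, θ⟩
        ⟨.down, Function.update η v (max (e.eval η) 0).toNNRat, a, θ⟩
  | concat1 (P Q η a θ C' η' a' θ') (h : Step ⟨.prog P, η, a, θ⟩ ⟨C', η', a', θ'⟩) :
      Step ⟨.prog (.seq P Q), η, a, θ⟩ ⟨.seq C' Q, η', a', θ'⟩
  | concat1' (C Q η a θ C' η' a' θ') (h : Step ⟨C, η, a, θ⟩ ⟨C', η', a', θ'⟩) :
      Step ⟨.seq C Q, η, a, θ⟩ ⟨.seq C' Q, η', a', θ'⟩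
  | concat2 (Q η a θ) : Step ⟨.seq .down Q, η, a, θ⟩ ⟨.prog Q, η, a, θ⟩
  | prob1 (p P Q η a θ) :
      Step ⟨.prog (.choice p P Q), η, a, θ⟩ ⟨.prog P, η, a * p.1, θ ++ [Dir.L]⟩
  | prob2 (p P Q η a θ) :
      Step ⟨.prog (.choice p P Q), η, a, θ⟩ ⟨.prog Q, η, a * (1 - p.1), θ ++ [Dir.R]⟩
  | while1 (b P η a θ) (h : b.eval η = true) :
      Step ⟨.prog (.loop b P), η, a, θ⟩ ⟨.prog (.seq P (.loop b P)), η, a, θ⟩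
  | while2 (b P η a θ) (h : b.eval η = false) :
      Step ⟨.prog (.loop b P), η, a, θ⟩ ⟨.down, η, a, θ⟩

/-- One step from a program, resolving a probabilistic choice by the first letter of `w`; returns
the successor state and the unread rest of `w`. -/
def nextProg (η : Valuation) (a : ℚ≥0) (θ w : List Dir) : Prog → Option (State × List Dir)
  | .assign v e => some (⟨.down, Function.update η v (max (e.eval η) 0).toNNRat, a, θ⟩, w)
  | .seq P Q =>
      (nextProg η a θ w P).map fun r => (⟨.seq r.1.ctrl Q, r.1.val, r.1.prob, r.1.trace⟩, r.2)
  | .choice p P Q =>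
      match w with
      | [] => none
      | true :: w' => some (⟨.prog P, η, a * p.1, θ ++ [Dir.L]⟩, w')
      | false :: w' => some (⟨.prog Q, η, a * (1 - p.1), θ ++ [Dir.R]⟩, w')
  | .loop b P =>
      if b.eval η then some (⟨.prog (.seq P (.loop b P)), η, a, θ⟩, w)
      else some (⟨.down, η, a, θ⟩, w)

/-- One step from an arbitrary control component, in the same manner. -/
def nextCtrl (η : Valuation) (a : ℚ≥0) (θ w : List Dir) : Ctrl → Option (State × List Dir)
  | .down => none
  | .prog P => nextProg η a θ w P
  | .seq .down Q => some (⟨.prog Q, η, a, θ⟩, w)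
  | .seq C Q =>
      (nextCtrl η a θ w C).map fun r => (⟨.seq r.1.ctrl Q, r.1.val, r.1.prob, r.1.trace⟩, r.2)

/-- One step from a state, in the same manner. -/
def next (σ : State) (w : List Dir) : Option (State × List Dir) :=
  nextCtrl σ.val σ.prob σ.trace w σ.ctrl

theorem next_of_step {σ τ : State} (h : Step σ τ) :
    ∃ b : List Dir, τ.trace = σ.trace ++ b ∧ ∀ w', next σ (b ++ w') = some (τ, w') := by
  induction h with
  | assign => exact ⟨[], by simp, fun w' => by simp [next, nextCtrl, nextProg]⟩
  | concat1 P Q η a θ C' η' a' θ' h ih =>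
    obtain ⟨b, hb, hn⟩ := ih
    refine ⟨b, hb, fun w' => ?_⟩
    have := hn w'
    simp only [next, nextCtrl] at this
    simp [next, nextCtrl, nextProg, this]
  | concat1' C Q η a θ C' η' a' θ' h ih =>
    obtain ⟨b, hb, hn⟩ := ih
    refine ⟨b, hb, fun w' => ?_⟩
    have := hn w'
    simp only [next] at this
    cases C with
    | down => cases h
    | prog P => simp [next, nextCtrl] at this ⊢; simp [this]
    | seq C P => simp only [next, nextCtrl]; simp [this]
  | concat2 => exact ⟨[], by simp, fun w' => by simp [next, nextCtrl]⟩
  | prob1 => exact ⟨[Dir.L], rfl, fun w' => by simp [next, nextCtrl, nextProg]⟩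
  | prob2 => exact ⟨[Dir.R], rfl, fun w' => by simp [next, nextCtrl, nextProg]⟩
  | while1 b P η a θ h => exact ⟨[], by simp, fun w' => by simp [next, nextCtrl, nextProg, h]⟩
  | while2 b P η a θ h => exact ⟨[], by simp, fun w' => by simp [next, nextCtrl, nextProg, h]⟩

theorem step_of_nextProg {η a θ w w'} {P : Prog} {τ : State}
    (h : nextProg η a θ w P = some (τ, w')) :
    Step ⟨.prog P, η, a, θ⟩ τ ∧ ∃ b, τ.trace = θ ++ b ∧ w = b ++ w' := by
  induction P generalizing τ w' with
  | assign v e =>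
    simp only [nextProg, Option.some.injEq, Prod.mk.injEq] at h
    obtain ⟨rfl, rfl⟩ := h
    exact ⟨.assign .., [], by simp, rfl⟩
  | seq P Q ihP _ =>
    simp only [nextProg, Option.map_eq_some_iff] at h
    obtain ⟨⟨ρ, u⟩, h1, h2⟩ := h
    simp only [Prod.mk.injEq] at h2
    obtain ⟨rfl, rfl⟩ := h2
    obtain ⟨hs, hb⟩ := ihP h1
    exact ⟨.concat1 _ _ _ _ _ _ _ _ _ hs, hb⟩
  | choice p P Q =>
    rcases w with _ | ⟨_ | _, w⟩
    · simp [nextProg] at h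
    · simp only [nextProg, Option.some.injEq, Prod.mk.injEq] at h
      obtain ⟨rfl, rfl⟩ := h
      exact ⟨.prob2 .., [Dir.R], rfl, rfl⟩
    · simp only [nextProg, Option.some.injEq, Prod.mk.injEq] at h
      obtain ⟨rfl, rfl⟩ := h
      exact ⟨.prob1 .., [Dir.L], rfl, rfl⟩
  | loop b P =>
    simp only [nextProg] at h
    split at h <;> rename_i hb <;> simp only [Option.some.injEq, Prod.mk.injEq] at h <;>
      obtain ⟨rfl, rfl⟩ := h
    · exact ⟨.while1 _ _ _ _ _ hb, [], by simp, rfl⟩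
    · exact ⟨.while2 _ _ _ _ _ (by simpa using hb), [], by simp, rfl⟩

theorem step_of_nextCtrl {η a θ w w'} {C : Ctrl} {τ : State}
    (h : nextCtrl η a θ w C = some (τ, w')) :
    Step ⟨C, η, a, θ⟩ τ ∧ ∃ b, τ.trace = θ ++ b ∧ w = b ++ w' := by
  induction C generalizing τ w' with
  | down => simp [nextCtrl] at h
  | prog P => exact step_of_nextProg h
  | seq C Q ih =>
    by_cases hC : C = .down
    · subst hC
      simp only [nextCtrl, Option.some.injEq, Prod.mk.injEq] at h
      obtain ⟨rfl, rfl⟩ := h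
      exact ⟨.concat2 .., [], by simp, rfl⟩
    · rw [nextCtrl.eq_4 _ _ _ _ _ _ (fun h => hC h), Option.map_eq_some_iff] at h
      obtain ⟨⟨ρ, u⟩, h1, h2⟩ := h
      simp only [Prod.mk.injEq] at h2
      obtain ⟨rfl, rfl⟩ := h2
      obtain ⟨hs, hb⟩ := ih h1
      exact ⟨.concat1' _ _ _ _ _ _ _ _ _ hs, hb⟩

/-- `next` computes the relation `⊢`: it moves from `σ` to `τ` reading `b` off the word iff
`σ ⊢ τ` and `b` is what this step appends to the sequence of choices. -/
theorem next_eq_some_iff {σ τ : State} {w w' : List Dir} :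
    next σ w = some (τ, w') ↔ Step σ τ ∧ ∃ b, τ.trace = σ.trace ++ b ∧ w = b ++ w' := by
  refine ⟨step_of_nextCtrl, ?_⟩
  rintro ⟨h, b, hb, rfl⟩
  obtain ⟨b', hb', hn⟩ := next_of_step h
  obtain rfl : b' = b := List.append_cancel_left (hb'.symm.trans hb)
  exact hn w'

/-- The state successor function `T`: the state reached from `σ` in exactly `k` steps in which
exactly the choices `w` are made, if there is one (`none` plays the role of `⊥`). -/
def T : ℕ → State → List Dir → Option State
  | 0, σ, w => if w = [] then some σ else none
  | k + 1, σ, w => (next σ w).bind fun r => T k r.1 r.2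

/-- The probability stored in a terminal state, and `0` for everything else. -/
def alpha : Option State → ℚ≥0
  | some ⟨.down, _, a, _⟩ => a
  | _ => 0

/-- The initial state of `P` on `η`. -/
def init (P : Prog) (η : Valuation) : State := ⟨.prog P, η, 1, []⟩

/-- The probability that `P` terminates on `η`: the sum over all `k` and all words `w` over
`{L, R}` of length at most `k` of `alpha (T k (init P η) w)`. -/
noncomputable def prTerm (P : Prog) (η : Valuation) : ℝ≥0∞ :=
  ∑' k : ℕ, ∑ i ∈ Finset.range (k + 1), ∑ w : List.Vector Dir i,
    ((alpha (T k (init P η) w.toList) : ℝ≥0) : ℝ≥0∞)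

/-! ## Inputs and the problem `AST` -/

/-- Inputs: the valuations that vanish outside a finite set of variables. -/
structure Input where
  val : Valuation
  finite_support : (Function.support val).Finite

/-- Almost-sure termination on a given input. -/
def AST : Set (Prog × Input) := {x | prTerm x.1 x.2.val = 1}

/-! ## Codings

Every class of objects is coded by natural numbers in the usual way: nonnegative rationals by
numerator and denominator, syntax trees by nested pairs, inputs by the finite list of their
values. Every natural number is the code of some object, and the primitive recursive function
`code ∘ ofCode` sends a number to the canonical code of the object it denotes. -/

/-- The code of a nonnegative rational. -/
def ratCode (q : ℚ≥0) : ℕ := Nat.pair q.num (q.den - 1)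

/-- The nonnegative rational with a given code. -/
def ratOfCode (n : ℕ) : ℚ≥0 := n.unpair.1 / (n.unpair.2 + 1 : ℕ)

theorem ratOfCode_ratCode (q : ℚ≥0) : ratOfCode (ratCode q) = q := by
  have : q.den - 1 + 1 = q.den := Nat.succ_pred_eq_of_pos q.den_pos
  simp only [ratOfCode, ratCode, Nat.unpair_pair, this]
  exact q.num_div_den

theorem primrec_gcd : Primrec₂ fun a b : ℕ => Nat.gcd a (b + 1) := by
  have hd : ∀ f g : (ℕ × ℕ) × ℕ → ℕ, Primrec f → Primrec g →
      PrimrecPred fun x => f x ∣ g x := fun f g hf hg =>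
    (Primrec.eq.comp (Primrec.nat_mod.comp hg hf) (Primrec.const 0)).of_eq
      fun x => (Nat.dvd_iff_mod_eq_zero).symm
  have h : Primrec fun x : ℕ × ℕ =>
      (x.2 + 1).findGreatest (fun d => d ∣ x.1 ∧ d ∣ x.2 + 1) := by
    refine Primrec.nat_findGreatest (Primrec.succ.comp Primrec.snd) ?_
    exact PrimrecPred.and
      (hd _ _ Primrec.snd (Primrec.fst.comp Primrec.fst))
      (hd _ _ Primrec.snd (Primrec.succ.comp (Primrec.snd.comp Primrec.fst)))
  refine h.of_eq fun x => ?_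
  rw [Nat.findGreatest_eq_iff]
  refine ⟨Nat.gcd_le_right _ (Nat.succ_pos _), fun _ => ⟨Nat.gcd_dvd_left .., Nat.gcd_dvd_right ..⟩,
    fun n hn _ hd => ?_⟩
  exact absurd (Nat.le_of_dvd (Nat.gcd_pos_of_pos_right _ (Nat.succ_pos _))
    (Nat.dvd_gcd hd.1 hd.2)) (not_le.2 hn)

theorem ratCode_ratOfCode (n : ℕ) : ratCode (ratOfCode n) =
    Nat.pair (n.unpair.1 / n.unpair.1.gcd (n.unpair.2 + 1))
      ((n.unpair.2 + 1) / n.unpair.1.gcd (n.unpair.2 + 1) - 1) := by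
  have h : ∀ a d : ℕ, 0 < d →
      ((a / d : ℚ≥0).num = a / a.gcd d ∧ (a / d : ℚ≥0).den = d / a.gcd d) := by
    intro a d hd
    have hg : 0 < a.gcd d := Nat.gcd_pos_of_pos_right _ hd
    have hc : Nat.Coprime (a / a.gcd d) (d / a.gcd d) := Nat.coprime_div_gcd_div_gcd hg
    have hd' : 0 < d / a.gcd d := Nat.div_pos (Nat.gcd_le_right _ hd) hg
    have hq : ((a / d : ℚ≥0) : ℚ) =
        (((a / a.gcd d : ℕ) : ℤ) : ℚ) / (((d / a.gcd d : ℕ) : ℤ) : ℚ) := by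
      have hg' : ((a.gcd d : ℕ) : ℚ) ≠ 0 := by exact_mod_cast hg.ne'
      rw [Int.cast_natCast, Int.cast_natCast, Nat.cast_div (Nat.gcd_dvd_left a d) hg',
        Nat.cast_div (Nat.gcd_dvd_right a d) hg', div_div_div_cancel_right₀ hg']
      push_cast
      rfl
    constructor
    · have := Rat.num_div_eq_of_coprime (a := ((a / a.gcd d : ℕ) : ℤ))
        (b := ((d / a.gcd d : ℕ) : ℤ)) (by exact_mod_cast hd') hc
      rw [NNRat.num, hq, this]
      exact Int.natAbs_natCast _
    · have := Rat.den_div_eq_of_coprime (a := ((a / a.gcd d : ℕ) : ℤ))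
        (b := ((d / a.gcd d : ℕ) : ℤ)) (by exact_mod_cast hd') hc
      rw [NNRat.den, hq]
      exact_mod_cast this
  obtain ⟨h1, h2⟩ := h n.unpair.1 (n.unpair.2 + 1) (Nat.succ_pos _)
  simp only [ratCode, ratOfCode, h1, h2]

theorem primrec_ratNorm : Primrec fun n => ratCode (ratOfCode n) := by
  have hg : Primrec fun n : ℕ => n.unpair.1.gcd (n.unpair.2 + 1) :=
    primrec_gcd.comp (Primrec.fst.comp Primrec.unpair) (Primrec.snd.comp Primrec.unpair)
  refine Primrec.of_eq ?_ fun n => (ratCode_ratOfCode n).symm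
  exact Primrec₂.natPair.comp
    (Primrec.nat_div.comp (Primrec.fst.comp Primrec.unpair) hg)
    (Primrec.pred.comp
      (Primrec.nat_div.comp (Primrec.succ.comp (Primrec.snd.comp Primrec.unpair)) hg))

/-- The probability with a given code. -/
def probOfCode (n : ℕ) : Prob := ⟨min (ratOfCode n) 1, min_le_right _ _⟩

theorem probOfCode_ratCode (p : Prob) : probOfCode (ratCode p.1) = p :=
  Subtype.ext (by simp [probOfCode, ratOfCode_ratCode, p.2])

theorem primrec_probNorm : Primrec fun n => ratCode (probOfCode n).1 := by
  have : Primrec fun n : ℕ =>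
      if n.unpair.1 ≤ n.unpair.2 + 1 then ratCode (ratOfCode n) else ratCode 1 :=
    Primrec.ite (Primrec.nat_le.comp (Primrec.fst.comp Primrec.unpair)
      (Primrec.succ.comp (Primrec.snd.comp Primrec.unpair))) primrec_ratNorm (Primrec.const _)
  refine this.of_eq fun n => ?_
  have hiff : ratOfCode n ≤ 1 ↔ n.unpair.1 ≤ n.unpair.2 + 1 := by
    rw [ratOfCode, div_le_one (by positivity)]; exact Nat.cast_le
  split
  · next h => simp only [probOfCode, min_eq_left (hiff.2 h)]
  · next h => simp only [probOfCode, min_eq_right (le_of_not_ge fun h' => h (hiff.1 h'))]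

/-- The code of a tree node with tag `t`, label `l` and the codes `x`, `y` of its children. -/
def node (t l x y : ℕ) : ℕ := Nat.pair t (Nat.pair l (Nat.pair x y))

/-- The tag of a tree code. -/
def ntag (n : ℕ) : ℕ := n.unpair.1

/-- The label of a tree code. -/
def nlab (n : ℕ) : ℕ := n.unpair.2.unpair.1

/-- The first child of a tree code. -/
def nfst (n : ℕ) : ℕ := n.unpair.2.unpair.2.unpair.1

/-- The second child of a tree code. -/
def nsnd (n : ℕ) : ℕ := n.unpair.2.unpair.2.unpair.2

@[simp] theorem ntag_node (t l x y : ℕ) : ntag (node t l x y) = t := by simp [ntag, node]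
@[simp] theorem nlab_node (t l x y : ℕ) : nlab (node t l x y) = l := by simp [nlab, node]
@[simp] theorem nfst_node (t l x y : ℕ) : nfst (node t l x y) = x := by simp [nfst, node]
@[simp] theorem nsnd_node (t l x y : ℕ) : nsnd (node t l x y) = y := by simp [nsnd, node]

theorem nfst_lt {n : ℕ} (h : ntag n ≠ 0) : nfst n < n := by
  have h1 := Nat.unpair_add_le n
  have h2 := Nat.unpair_right_le n.unpair.2
  have h3 := Nat.unpair_left_le n.unpair.2.unpair.2
  simp only [ntag, nfst] at *
  omega

theorem nsnd_lt {n : ℕ} (h : ntag n ≠ 0) : nsnd n < n := by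
  have h1 := Nat.unpair_add_le n
  have h2 := Nat.unpair_right_le n.unpair.2
  have h3 := Nat.unpair_right_le n.unpair.2.unpair.2
  simp only [ntag, nsnd] at *
  omega

theorem primrec_node {α : Type} [Primcodable α] {t l x y : α → ℕ} (ht : Primrec t)
    (hl : Primrec l) (hx : Primrec x) (hy : Primrec y) :
    Primrec fun a => node (t a) (l a) (x a) (y a) :=
  Primrec₂.natPair.comp ht (Primrec₂.natPair.comp hl (Primrec₂.natPair.comp hx hy))

theorem primrec_ntag : Primrec ntag := Primrec.fst.comp Primrec.unpair

theorem primrec_nlab : Primrec nlab :=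
  Primrec.fst.comp (Primrec.unpair.comp (Primrec.snd.comp Primrec.unpair))

theorem primrec_nfst : Primrec nfst :=
  Primrec.fst.comp (Primrec.unpair.comp (Primrec.snd.comp
    (Primrec.unpair.comp (Primrec.snd.comp Primrec.unpair))))

theorem primrec_nsnd : Primrec nsnd :=
  Primrec.snd.comp (Primrec.unpair.comp (Primrec.snd.comp
    (Primrec.unpair.comp (Primrec.snd.comp Primrec.unpair))))

/-- Recursion over tree codes is primitive recursive. -/
theorem primrec_tree {f : ℕ → ℕ} {G : ℕ × ℕ × ℕ × ℕ → ℕ} (hG : Primrec G)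
    (hf : ∀ n, f n = G (ntag n, nlab n, if ntag n = 0 then 0 else f (nfst n),
      if ntag n = 0 then 0 else f (nsnd n))) : Primrec f := by
  have len : Primrec fun x : Unit × List ℕ => x.2.length := Primrec.list_length.comp Primrec.snd
  have child : ∀ c : ℕ → ℕ, Primrec c → Primrec fun x : Unit × List ℕ =>
      if ntag x.2.length = 0 then 0 else x.2.getD (c x.2.length) 0 := fun c hc =>
    Primrec.ite (Primrec.eq.comp (primrec_ntag.comp len) (Primrec.const 0)) (Primrec.const 0)
      ((Primrec.list_getD 0).comp Primrec.snd (hc.comp len))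
  have key : Primrec₂ fun (_ : Unit) n => f n := by
    refine Primrec.nat_strong_rec _ (g := fun _ l => some (G (ntag l.length, nlab l.length,
      if ntag l.length = 0 then 0 else l.getD (nfst l.length) 0,
      if ntag l.length = 0 then 0 else l.getD (nsnd l.length) 0))) ?_ ?_
    · exact Primrec.option_some.comp (hG.comp (Primrec.pair (primrec_ntag.comp len)
        (Primrec.pair (primrec_nlab.comp len)
          (Primrec.pair (child _ primrec_nfst) (child _ primrec_nsnd)))))
    · intro _ n
      simp only [List.length_map, List.length_range]
      rw [hf n]
      by_cases h : ntag n = 0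
      · simp [h]
      · simp [h, List.getD, nfst_lt h, nsnd_lt h]
  exact key.comp (Primrec.const ()) Primrec.id

/-- The code of an arithmetical expression. -/
def AExp.code : AExp → ℕ
  | .const q => node 0 (ratCode q) 0 0
  | .var v => node 1 v 0 0
  | .add e₁ e₂ => node 2 0 e₁.code e₂.code
  | .sub e₁ e₂ => node 3 0 e₁.code e₂.code
  | .mul e₁ e₂ => node 4 0 e₁.code e₂.code

/-- The arithmetical expression with a given code. -/
def AExp.ofCode (n : ℕ) : AExp :=
  if ntag n = 0 then .const (ratOfCode (nlab n))
  else if ntag n = 1 then .var (nlab n)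
  else if ntag n = 2 then .add (AExp.ofCode (nfst n)) (AExp.ofCode (nsnd n))
  else if ntag n = 3 then .sub (AExp.ofCode (nfst n)) (AExp.ofCode (nsnd n))
  else .mul (AExp.ofCode (nfst n)) (AExp.ofCode (nsnd n))
termination_by n
decreasing_by all_goals first
  | with_reducible exact nfst_lt (by assumption)
  | with_reducible exact nsnd_lt (by assumption)

theorem AExp.ofCode_code (e : AExp) : AExp.ofCode e.code = e := by
  induction e with
  | const q => rw [AExp.ofCode]; simp [AExp.code, ratOfCode_ratCode]
  | var v => rw [AExp.ofCode]; simp [AExp.code]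
  | add _ _ h₁ h₂ => rw [AExp.ofCode]; simp [AExp.code, h₁, h₂]
  | sub _ _ h₁ h₂ => rw [AExp.ofCode]; simp [AExp.code, h₁, h₂]
  | mul _ _ h₁ h₂ => rw [AExp.ofCode]; simp [AExp.code, h₁, h₂]

theorem primrec_tagIs (k : ℕ) : PrimrecPred fun x : ℕ × ℕ × ℕ × ℕ => x.1 = k :=
  Primrec.eq.comp Primrec.fst (Primrec.const k)

theorem AExp.primrec_norm : Primrec fun n => (AExp.ofCode n).code := by
  have l : Primrec fun x : ℕ × ℕ × ℕ × ℕ => x.2.1 := Primrec.fst.comp Primrec.snd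
  have c : Primrec fun x : ℕ × ℕ × ℕ × ℕ => x.2.2.1 :=
    Primrec.fst.comp (Primrec.snd.comp Primrec.snd)
  have d : Primrec fun x : ℕ × ℕ × ℕ × ℕ => x.2.2.2 :=
    Primrec.snd.comp (Primrec.snd.comp Primrec.snd)
  have k : ∀ m : ℕ, Primrec fun _ : ℕ × ℕ × ℕ × ℕ => m := fun m => Primrec.const m
  refine primrec_tree (G := fun x =>
    if x.1 = 0 then node 0 (ratCode (ratOfCode x.2.1)) 0 0
    else if x.1 = 1 then node 1 x.2.1 0 0
    else if x.1 = 2 then node 2 0 x.2.2.1 x.2.2.2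
    else if x.1 = 3 then node 3 0 x.2.2.1 x.2.2.2
    else node 4 0 x.2.2.1 x.2.2.2) ?_ ?_
  · exact Primrec.ite (primrec_tagIs 0) (primrec_node (k 0) (primrec_ratNorm.comp l) (k 0) (k 0))
      (Primrec.ite (primrec_tagIs 1) (primrec_node (k 1) l (k 0) (k 0))
        (Primrec.ite (primrec_tagIs 2) (primrec_node (k 2) (k 0) c d)
          (Primrec.ite (primrec_tagIs 3) (primrec_node (k 3) (k 0) c d)
            (primrec_node (k 4) (k 0) c d))))
  · intro n
    rw [AExp.ofCode]
    by_cases h0 : ntag n = 0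
    · simp [h0, AExp.code]
    by_cases h1 : ntag n = 1
    · simp [h1, AExp.code]
    by_cases h2 : ntag n = 2
    · simp [h2, AExp.code]
    by_cases h3 : ntag n = 3
    · simp [h3, AExp.code]
    simp [h0, h1, h2, h3, AExp.code]

/-- The code of a Boolean expression. -/
def BExp.code : BExp → ℕ
  | .eq e₁ e₂ => node 0 (Nat.pair e₁.code e₂.code) 0 0
  | .lt e₁ e₂ => node 1 (Nat.pair e₁.code e₂.code) 0 0
  | .not b => node 2 0 b.code 0
  | .and b₁ b₂ => node 3 0 b₁.code b₂.code

/-- The Boolean expression with a given code. -/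
def BExp.ofCode (n : ℕ) : BExp :=
  if ntag n = 0 then .eq (AExp.ofCode (nlab n).unpair.1) (AExp.ofCode (nlab n).unpair.2)
  else if ntag n = 1 then .lt (AExp.ofCode (nlab n).unpair.1) (AExp.ofCode (nlab n).unpair.2)
  else if ntag n = 2 then .not (BExp.ofCode (nfst n))
  else .and (BExp.ofCode (nfst n)) (BExp.ofCode (nsnd n))
termination_by n
decreasing_by all_goals first
  | with_reducible exact nfst_lt (by assumption)
  | with_reducible exact nsnd_lt (by assumption)

theorem BExp.ofCode_code (b : BExp) : BExp.ofCode b.code = b := by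
  induction b with
  | eq e₁ e₂ => rw [BExp.ofCode]; simp [BExp.code, AExp.ofCode_code]
  | lt e₁ e₂ => rw [BExp.ofCode]; simp [BExp.code, AExp.ofCode_code]
  | not _ h => rw [BExp.ofCode]; simp [BExp.code, h]
  | and _ _ h₁ h₂ => rw [BExp.ofCode]; simp [BExp.code, h₁, h₂]

theorem BExp.primrec_norm : Primrec fun n => (BExp.ofCode n).code := by
  have l : Primrec fun x : ℕ × ℕ × ℕ × ℕ =>
      Nat.pair (AExp.ofCode x.2.1.unpair.1).code (AExp.ofCode x.2.1.unpair.2).code :=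
    Primrec₂.natPair.comp
      (AExp.primrec_norm.comp (Primrec.fst.comp (Primrec.unpair.comp
        (Primrec.fst.comp Primrec.snd))))
      (AExp.primrec_norm.comp (Primrec.snd.comp (Primrec.unpair.comp
        (Primrec.fst.comp Primrec.snd))))
  have c : Primrec fun x : ℕ × ℕ × ℕ × ℕ => x.2.2.1 :=
    Primrec.fst.comp (Primrec.snd.comp Primrec.snd)
  have d : Primrec fun x : ℕ × ℕ × ℕ × ℕ => x.2.2.2 :=
    Primrec.snd.comp (Primrec.snd.comp Primrec.snd)
  have k : ∀ m : ℕ, Primrec fun _ : ℕ × ℕ × ℕ × ℕ => m := fun m => Primrec.const m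
  refine primrec_tree (G := fun x =>
    if x.1 = 0 then node 0
      (Nat.pair (AExp.ofCode x.2.1.unpair.1).code (AExp.ofCode x.2.1.unpair.2).code) 0 0
    else if x.1 = 1 then node 1
      (Nat.pair (AExp.ofCode x.2.1.unpair.1).code (AExp.ofCode x.2.1.unpair.2).code) 0 0
    else if x.1 = 2 then node 2 0 x.2.2.1 0
    else node 3 0 x.2.2.1 x.2.2.2) ?_ ?_
  · exact Primrec.ite (primrec_tagIs 0) (primrec_node (k 0) l (k 0) (k 0))
      (Primrec.ite (primrec_tagIs 1) (primrec_node (k 1) l (k 0) (k 0))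
        (Primrec.ite (primrec_tagIs 2) (primrec_node (k 2) (k 0) c (k 0))
          (primrec_node (k 3) (k 0) c d)))
  · intro n
    rw [BExp.ofCode]
    by_cases h0 : ntag n = 0
    · simp [h0, BExp.code]
    by_cases h1 : ntag n = 1
    · simp [h1, BExp.code]
    by_cases h2 : ntag n = 2
    · simp [h2, BExp.code]
    simp [h0, h1, h2, BExp.code]

/-- The code of a program. -/
def Prog.code : Prog → ℕ
  | .assign v e => node 0 (Nat.pair v e.code) 0 0
  | .seq P Q => node 1 0 P.code Q.code
  | .choice p P Q => node 2 (ratCode p.1) P.code Q.code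
  | .loop b P => node 3 b.code P.code 0

/-- The program with a given code. -/
def Prog.ofCode (n : ℕ) : Prog :=
  if ntag n = 0 then .assign (nlab n).unpair.1 (AExp.ofCode (nlab n).unpair.2)
  else if ntag n = 1 then .seq (Prog.ofCode (nfst n)) (Prog.ofCode (nsnd n))
  else if ntag n = 2 then
    .choice (probOfCode (nlab n)) (Prog.ofCode (nfst n)) (Prog.ofCode (nsnd n))
  else .loop (BExp.ofCode (nlab n)) (Prog.ofCode (nfst n))
termination_by n
decreasing_by all_goals first
  | with_reducible exact nfst_lt (by assumption)
  | with_reducible exact nsnd_lt (by assumption)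

theorem Prog.ofCode_code (P : Prog) : Prog.ofCode P.code = P := by
  induction P with
  | assign v e => rw [Prog.ofCode]; simp [Prog.code, AExp.ofCode_code]
  | seq _ _ h₁ h₂ => rw [Prog.ofCode]; simp [Prog.code, h₁, h₂]
  | choice p _ _ h₁ h₂ => rw [Prog.ofCode]; simp [Prog.code, h₁, h₂, probOfCode_ratCode]
  | loop b _ h => rw [Prog.ofCode]; simp [Prog.code, h, BExp.ofCode_code]

theorem Prog.primrec_norm : Primrec fun n => (Prog.ofCode n).code := by
  have l : Primrec fun x : ℕ × ℕ × ℕ × ℕ => x.2.1 := Primrec.fst.comp Primrec.snd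
  have c : Primrec fun x : ℕ × ℕ × ℕ × ℕ => x.2.2.1 :=
    Primrec.fst.comp (Primrec.snd.comp Primrec.snd)
  have d : Primrec fun x : ℕ × ℕ × ℕ × ℕ => x.2.2.2 :=
    Primrec.snd.comp (Primrec.snd.comp Primrec.snd)
  have k : ∀ m : ℕ, Primrec fun _ : ℕ × ℕ × ℕ × ℕ => m := fun m => Primrec.const m
  refine primrec_tree (G := fun x =>
    if x.1 = 0 then node 0 (Nat.pair x.2.1.unpair.1 (AExp.ofCode x.2.1.unpair.2).code) 0 0
    else if x.1 = 1 then node 1 0 x.2.2.1 x.2.2.2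
    else if x.1 = 2 then node 2 (ratCode (probOfCode x.2.1).1) x.2.2.1 x.2.2.2
    else node 3 (BExp.ofCode x.2.1).code x.2.2.1 0) ?_ ?_
  · exact Primrec.ite (primrec_tagIs 0) (primrec_node (k 0)
        (Primrec₂.natPair.comp (Primrec.fst.comp (Primrec.unpair.comp l))
          (AExp.primrec_norm.comp (Primrec.snd.comp (Primrec.unpair.comp l)))) (k 0) (k 0))
      (Primrec.ite (primrec_tagIs 1) (primrec_node (k 1) (k 0) c d)
        (Primrec.ite (primrec_tagIs 2) (primrec_node (k 2) (primrec_probNorm.comp l) c d)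
          (primrec_node (k 3) (BExp.primrec_norm.comp l) c (k 0))))
  · intro n
    rw [Prog.ofCode]
    by_cases h0 : ntag n = 0
    · simp [h0, Prog.code]
    by_cases h1 : ntag n = 1
    · simp [h1, Prog.code]
    by_cases h2 : ntag n = 2
    · simp [h2, Prog.code]
    simp [h0, h1, h2, Prog.code]

instance : Primcodable Prog where
  encode := Prog.code
  decode n := some (Prog.ofCode n)
  encodek P := congrArg some P.ofCode_code
  prim := Nat.Primrec.succ.comp (Primrec.nat_iff.1 Prog.primrec_norm)

/-- The length of the shortest initial segment of the variables outside which `η` vanishes. -/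
noncomputable def inputLen (η : Input) : ℕ := η.finite_support.toFinset.sup Nat.succ

/-- The list of the codes of the values of an input on this segment. -/
noncomputable def inputList (η : Input) : List ℕ :=
  (List.range (inputLen η)).map fun v => ratCode (η.val v)

/-- The input with a given list of codes of values. -/
def inputOfList (l : List ℕ) : Input where
  val v := ratOfCode (l.getD v 0)
  finite_support := (Set.finite_lt_nat l.length).subset fun v h => by
    by_contra hv
    rw [Set.mem_ofPred_eq, not_lt] at hv
    exact h (by simp [List.getD, hv, ratOfCode])

theorem inputLen_le_iff {η : Input} {m : ℕ} : inputLen η ≤ m ↔ ∀ v, m ≤ v → η.val v = 0 := by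
  rw [inputLen, Finset.sup_le_iff]
  simp only [Set.Finite.mem_toFinset, Function.mem_support, Nat.succ_le_iff]
  exact forall_congr' fun v => by rw [← not_lt, not_imp_comm]

theorem inputOfList_inputList (η : Input) : inputOfList (inputList η) = η := by
  have h : (inputOfList (inputList η)).val = η.val := by
    funext v
    by_cases hv : v < inputLen η
    · simp [inputOfList, inputList, List.getD, hv, ratOfCode_ratCode]
    · simp [inputOfList, inputList, List.getD, hv, inputLen_le_iff.1 le_rfl v (not_lt.1 hv),
        ratOfCode]
  cases η
  cases hη : inputOfList _
  simp_all

theorem inputLen_inputOfList (l : List ℕ) : inputLen (inputOfList l) =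
    l.length.findGreatest (fun m => (l.getD (m - 1) 0).unpair.1 ≠ 0) := by
  have h0 : ∀ v, (inputOfList l).val v = 0 ↔ (l.getD v 0).unpair.1 = 0 := fun v => by
    simp only [inputOfList, ratOfCode, div_eq_zero_iff, Nat.cast_eq_zero, Nat.succ_ne_zero,
      or_false]
  apply le_antisymm
  · rw [inputLen_le_iff]
    intro v hv
    by_contra h
    have hl : v < l.length := by
      by_contra hl
      exact h (by simp [inputOfList, List.getD, not_lt.1 hl, ratOfCode])
    have := Nat.le_findGreatest (P := fun m => (l.getD (m - 1) 0).unpair.1 ≠ 0)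
      (Nat.succ_le_of_lt hl) (by simpa using fun h' => h ((h0 v).2 h'))
    omega
  · by_contra hlt
    rw [not_le] at hlt
    have := Nat.findGreatest_of_ne_zero (P := fun m => (l.getD (m - 1) 0).unpair.1 ≠ 0) rfl
      (Nat.ne_of_gt (lt_of_le_of_lt (Nat.zero_le _) hlt))
    exact this ((h0 _).1 (inputLen_le_iff.1 le_rfl _ (Nat.le_sub_one_of_lt hlt)))

theorem primrec_inputNorm : Primrec fun l => inputList (inputOfList l) := by
  have hlen : Primrec fun l => inputLen (inputOfList l) := by
    refine Primrec.of_eq ?_ fun l => (inputLen_inputOfList l).symm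
    refine Primrec.nat_findGreatest (p := fun (l : List ℕ) m => (l.getD (m - 1) 0).unpair.1 ≠ 0)
      Primrec.list_length (PrimrecPred.not ?_)
    exact Primrec.eq.comp (Primrec.fst.comp (Primrec.unpair.comp ((Primrec.list_getD 0).comp
      Primrec.fst (Primrec.pred.comp Primrec.snd)))) (Primrec.const 0)
  refine Primrec.list_map (Primrec.list_range.comp hlen) ?_
  exact primrec_ratNorm.comp (Primrec.list_getD 0)

noncomputable instance : Primcodable Input where
  encode η := Encodable.encode (inputList η)
  decode n := some (inputOfList (Denumerable.ofNat (List ℕ) n))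
  encodek η := by simp [inputOfList_inputList]
  prim := Nat.Primrec.succ.comp (Primrec.nat_iff.1
    (Primrec.encode.comp (primrec_inputNorm.comp (Primrec.ofNat (List ℕ)))))

end PGCL

/-!
A program has finitely many weighted successors at every step, so the probability of halting within
`n` steps is a primitive recursive rational number, and it increases to the probability of
termination. The latter therefore equals `1` if and only if for every `m` some `n` pushes it beyond
`m / (m + 1)`, which is a `Π₂⁰` condition.

Conversely, a `Π₂⁰` set can be written `{X | ∀ y, ∃ z, h X y z = 0}` with `h` primitive recursive,
and `h` is computed by a deterministic program. For `y = 0, 1, …` search for a `z` with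
`h X y z = 0`, and after each success stop with probability one half. If every search succeeds, the
probability of running through `n` rounds is `2⁻ⁿ` and the program terminates almost surely; if the
search for some `y` fails, it is started with positive probability and never ends.
-/

namespace PGCL

/-! ## Rational arithmetic is primitive recursive -/

instance : Primcodable ℚ≥0 where
  encode := ratCode
  decode n := some (ratOfCode n)
  encodek q := congrArg some (ratOfCode_ratCode q)
  prim := Nat.Primrec.succ.comp (Primrec.nat_iff.1 primrec_ratNorm)

theorem primrec_ratCode : Primrec ratCode := Primrec.encode

theorem primrec_ratOfCode : Primrec ratOfCode := Primrec.encode_iff.1 primrec_ratNorm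

theorem primrec_num : Primrec NNRat.num :=
  (Primrec.fst.comp (Primrec.unpair.comp primrec_ratCode)).of_eq fun q => by simp [ratCode]

theorem primrec_den : Primrec NNRat.den :=
  (Primrec.succ.comp (Primrec.snd.comp (Primrec.unpair.comp primrec_ratCode))).of_eq fun q => by
    simp [ratCode, Nat.sub_add_cancel q.den_pos]

theorem primrec_natDivSucc : Primrec₂ fun a b : ℕ => (a : ℚ≥0) / ((b + 1 : ℕ) : ℚ≥0) :=
  (primrec_ratOfCode.comp Primrec₂.natPair).of_eq fun x => by simp [ratOfCode]

theorem primrec_ratOp {op : ℚ≥0 → ℚ≥0 → ℚ≥0} {N : ℚ≥0 → ℚ≥0 → ℕ} (hN : Primrec₂ N)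
    (h : ∀ p q, op p q = N p q / ((p.den * q.den : ℕ) : ℚ≥0)) : Primrec₂ op := by
  have hden : Primrec₂ fun p q : ℚ≥0 => p.den * q.den :=
    Primrec.nat_mul.comp (primrec_den.comp Primrec.fst) (primrec_den.comp Primrec.snd)
  refine (primrec_natDivSucc.comp₂ hN (Primrec.pred.comp₂ hden)).of_eq fun p q => ?_
  have hpos : 0 < p.den * q.den := Nat.mul_pos p.den_pos q.den_pos
  rw [h, Nat.pred_eq_sub_one, Nat.sub_add_cancel hpos]

theorem primrec_num_mul_den : Primrec₂ fun p q : ℚ≥0 => p.num * q.den :=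
  Primrec.nat_mul.comp (primrec_num.comp Primrec.fst) (primrec_den.comp Primrec.snd)

theorem divNat_eq_div (a b : ℕ) : NNRat.divNat a b = (a : ℚ≥0) / b := by
  ext
  simp

theorem primrec_ratAdd : Primrec₂ ((· + ·) : ℚ≥0 → ℚ≥0 → ℚ≥0) :=
  primrec_ratOp (Primrec.nat_add.comp₂ primrec_num_mul_den primrec_num_mul_den.swap) fun p q => by
    rw [NNRat.add_def, divNat_eq_div]

theorem primrec_ratMul : Primrec₂ ((· * ·) : ℚ≥0 → ℚ≥0 → ℚ≥0) :=
  primrec_ratOp (Primrec.nat_mul.comp₂ (primrec_num.comp₂ Primrec₂.left)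
    (primrec_num.comp₂ Primrec₂.right)) fun p q => by rw [NNRat.mul_def, divNat_eq_div]

theorem primrec_ratSub : Primrec₂ ((· - ·) : ℚ≥0 → ℚ≥0 → ℚ≥0) := by
  refine primrec_ratOp (Primrec.nat_sub.comp₂ primrec_num_mul_den primrec_num_mul_den.swap)
    fun p q => ?_
  have hp : (p.den : ℚ≥0) ≠ 0 := Nat.cast_ne_zero.2 p.den_ne_zero
  have hq : (q.den : ℚ≥0) ≠ 0 := Nat.cast_ne_zero.2 q.den_ne_zero
  rw [Nat.cast_tsub, tsub_div]
  conv_lhs => rw [← NNRat.num_div_den p, ← NNRat.num_div_den q]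
  push_cast
  congr 1 <;> field_simp

theorem primrec_ratLt : PrimrecRel ((· < ·) : ℚ≥0 → ℚ≥0 → Prop) :=
  (Primrec.nat_lt.comp₂ primrec_num_mul_den primrec_num_mul_den.swap).of_eq fun _ _ =>
    NNRat.lt_def.symm

theorem primrec_ratSum : Primrec (List.sum : List ℚ≥0 → ℚ≥0) :=
  Primrec.list_foldr Primrec.id (Primrec.const 0)
    (primrec_ratAdd.comp₂ (Primrec.fst.comp₂ Primrec₂.right) (Primrec.snd.comp₂ Primrec₂.right))

theorem primrec_singleton {α : Type*} [Primcodable α] : Primrec fun a : α => [a] :=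
  Primrec.list_cons.comp Primrec.id (Primrec.const [])

/-! ## Weighted transition systems -/

/-- A finitely branching transition system with weights: each configuration is sent to the list of
its weighted successors, and it has halted when this list is empty. -/
abbrev WeightedSystem (S : Type*) := S → List (ℚ≥0 × S)

namespace WeightedSystem

section HaltingProbability

variable {S : Type*} (M : WeightedSystem S)

/-- The probability of halting after exactly `k` steps. -/
def haltProb : ℕ → S → ℚ≥0
  | 0, c => if (M c).isEmpty then 1 else 0
  | k + 1, c => ((M c).map fun r => r.1 * haltProb k r.2).sum

/-- The probability of halting eventually. -/
noncomputable def haltTotal (c : S) : ℝ≥0∞ := ∑' k, ((M.haltProb k c : ℝ≥0) : ℝ≥0∞)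

/-- A step that is taken with probability one. -/
def DetStep (c d : S) : Prop := M c = [(1, d)]

variable {M}

theorem sum_haltProb_succ (n : ℕ) (c : S) :
    ∑ k ∈ Finset.range (n + 1), M.haltProb k c =
      M.haltProb 0 c + ((M c).map fun r => r.1 * ∑ k ∈ Finset.range n, M.haltProb k r.2).sum := by
  have swap (L : List (ℚ≥0 × S)) :
      ∑ k ∈ Finset.range n, (L.map fun r => r.1 * M.haltProb k r.2).sum =
        (L.map fun r => r.1 * ∑ k ∈ Finset.range n, M.haltProb k r.2).sum := by
    induction L with
    | nil => simp
    | cons r L ih => simp [Finset.sum_add_distrib, ih, Finset.mul_sum]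
  rw [Finset.sum_range_succ', add_comm, ← swap]
  rfl

theorem sum_haltProb_le_one (hM : ∀ c, ((M c).map Prod.fst).sum ≤ 1) (n : ℕ) (c : S) :
    ∑ k ∈ Finset.range n, M.haltProb k c ≤ 1 := by
  induction n generalizing c with
  | zero => simp
  | succ n ih =>
    rw [sum_haltProb_succ]
    rcases hc : M c with _ | ⟨r, L⟩
    · simp [haltProb, hc]
    · calc M.haltProb 0 c + ((r :: L).map fun r => r.1 * ∑ k ∈ Finset.range n, M.haltProb k r.2).sum
          ≤ 0 + ((r :: L).map Prod.fst).sum :=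
            add_le_add (by simp [haltProb, hc])
              (List.sum_le_sum fun r _ => mul_le_of_le_one_right' (ih r.2))
        _ ≤ 1 := by simpa only [zero_add, hc] using hM c

theorem coe_sum_haltProb (n : ℕ) (c : S) :
    (((∑ k ∈ Finset.range n, M.haltProb k c : ℚ≥0) : ℝ≥0) : ℝ≥0∞) =
      ∑ k ∈ Finset.range n, ((M.haltProb k c : ℝ≥0) : ℝ≥0∞) := by
  rw [NNRat.cast_sum, ENNReal.ofNNReal_finsetSum]

theorem haltTotal_le_one (hM : ∀ c, ((M c).map Prod.fst).sum ≤ 1) (c : S) : M.haltTotal c ≤ 1 :=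
  ENNReal.tsum_le_of_sum_range_le fun n => by
    rw [← coe_sum_haltProb]
    exact_mod_cast sum_haltProb_le_one hM n c

theorem lt_haltTotal_iff {q : ℚ≥0} {c : S} :
    ((q : ℝ≥0) : ℝ≥0∞) < M.haltTotal c ↔ ∃ n, q < ∑ k ∈ Finset.range n, M.haltProb k c := by
  simp only [haltTotal, ENNReal.tsum_eq_iSup_nat, lt_iSup_iff, ← coe_sum_haltProb,
    ENNReal.coe_lt_coe, NNRat.cast_lt]

theorem haltTotal_eq_add (c : S) : M.haltTotal c = ((M.haltProb 0 c : ℝ≥0) : ℝ≥0∞) +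
    ((M c).map fun r => ((r.1 : ℝ≥0) : ℝ≥0∞) * M.haltTotal r.2).sum := by
  have swap (L : List (ℚ≥0 × S)) :
      ∑' k, ((((L.map fun r => r.1 * M.haltProb k r.2).sum : ℚ≥0) : ℝ≥0) : ℝ≥0∞) =
        (L.map fun r => ((r.1 : ℝ≥0) : ℝ≥0∞) * M.haltTotal r.2).sum := by
    induction L with
    | nil => simp
    | cons r L ih => simp [ENNReal.tsum_add, ih, ENNReal.tsum_mul_left, haltTotal]
  rw [← swap, haltTotal, tsum_eq_zero_add' ENNReal.summable]
  rfl

theorem haltTotal_congr {c d : S} (h : M c = M d) : M.haltTotal c = M.haltTotal d := by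
  rw [haltTotal_eq_add, haltTotal_eq_add, haltProb, haltProb, h]

theorem haltTotal_of_eq_nil {c : S} (h : M c = []) : M.haltTotal c = 1 := by
  simp [haltTotal_eq_add c, haltProb, h]

theorem haltTotal_of_eq_pair {c d₁ d₂ : S} {p₁ p₂ : ℚ≥0} (h : M c = [(p₁, d₁), (p₂, d₂)]) :
    M.haltTotal c =
      ((p₁ : ℝ≥0) : ℝ≥0∞) * M.haltTotal d₁ + ((p₂ : ℝ≥0) : ℝ≥0∞) * M.haltTotal d₂ := by
  simp [haltTotal_eq_add c, haltProb, h]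

theorem DetStep.haltTotal_eq {c d : S} (h : M.DetStep c d) : M.haltTotal c = M.haltTotal d := by
  rw [DetStep] at h
  simp [haltTotal_eq_add c, haltProb, h]

theorem haltTotal_eq_of_transGen {c d : S} (h : Relation.TransGen M.DetStep c d) :
    M.haltTotal c = M.haltTotal d := by
  induction h with
  | single h => exact h.haltTotal_eq
  | tail _ h ih => exact ih.trans h.haltTotal_eq

theorem haltTotal_eq_zero_of_forall_transGen {A : Set S}
    (hA : ∀ c ∈ A, ∃ d ∈ A, Relation.TransGen M.DetStep c d) {c : S} (hc : c ∈ A) :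
    M.haltTotal c = 0 := by
  have step (c : S) (hc : ∃ d ∈ A, Relation.TransGen M.DetStep c d) :
      ∃ e, M.DetStep c e ∧ ∃ d ∈ A, Relation.TransGen M.DetStep e d := by
    obtain ⟨d, hd, hcd⟩ := hc
    obtain ⟨e, hce, hed⟩ := Relation.TransGen.head'_iff.1 hcd
    rcases Relation.reflTransGen_iff_eq_or_transGen.1 hed with rfl | hed
    · exact ⟨d, hce, hA d hd⟩
    · exact ⟨e, hce, d, hd, hed⟩
  have haltProb_eq_zero (k : ℕ) : ∀ c, (∃ d ∈ A, Relation.TransGen M.DetStep c d) →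
      M.haltProb k c = 0 := by
    induction k with
    | zero =>
      intro c hc
      obtain ⟨e, hce, -⟩ := step c hc
      rw [DetStep] at hce
      simp [haltProb, hce]
    | succ k ih =>
      intro c hc
      obtain ⟨e, hce, he⟩ := step c hc
      rw [DetStep] at hce
      simp [haltProb, hce, ih e he]
  simp [haltTotal, haltProb_eq_zero _ c (hA c hc)]

end HaltingProbability

end WeightedSystem

theorem one_le_iff_forall_natDivSucc_lt {x : ℝ≥0∞} :
    1 ≤ x ↔ ∀ m : ℕ, (((m / (m + 1 : ℕ) : ℚ≥0) : ℝ≥0) : ℝ≥0∞) < x := by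
  refine ⟨fun hx m => lt_of_lt_of_le ?_ hx,
    fun h => le_of_tendsto' (x := Filter.atTop) ?_ fun m => (h m).le⟩
  · have : (m / (m + 1 : ℕ) : ℚ≥0) < 1 :=
      (div_lt_one (by positivity)).2 (Nat.cast_lt.2 m.lt_succ_self)
    exact_mod_cast this
  · refine ENNReal.tendsto_coe.2 (NNReal.tendsto_coe.1 ?_)
    simpa using tendsto_natCast_div_add_atTop (1 : ℝ)

theorem one_le_of_forall_exists_mix_le {S : Type*} {A : Set S} {F : S → ℝ≥0∞} {p q : ℝ≥0∞}
    (hp : p ≠ 0) (hpq : p + q = 1) (hA : ∀ c ∈ A, ∃ d ∈ A, p + q * F d ≤ F c) {c : S}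
    (hc : c ∈ A) : 1 ≤ F c := by
  have hp' : p ≠ ⊤ := ne_top_of_le_ne_top ENNReal.one_ne_top (hpq ▸ le_self_add)
  have hq' : q ≠ ⊤ := ne_top_of_le_ne_top ENNReal.one_ne_top (hpq ▸ le_add_self)
  suffices 1 ≤ ⨅ d ∈ A, F d from this.trans (iInf₂_le c hc)
  set m := ⨅ d ∈ A, F d
  have mix_le : p + q * m ≤ m := le_iInf₂ fun c hc => by
    obtain ⟨d, hd, hcd⟩ := hA c hc
    exact le_trans (by gcongr; exact iInf₂_le d hd) hcd
  by_cases h : m = ⊤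
  · simp [h]
  · have : p * 1 + q * m ≤ p * m + q * m := by rwa [← add_mul, hpq, one_mul, mul_one]
    rwa [ENNReal.add_le_add_iff_right (ENNReal.mul_ne_top hq' h),
      ENNReal.mul_le_mul_iff_right hp hp'] at this

namespace WeightedSystem

theorem haltTotal_eq_one_iff {S : Type*} {M : WeightedSystem S}
    (hM : ∀ c, ((M c).map Prod.fst).sum ≤ 1) {c : S} :
    M.haltTotal c = 1 ↔
      ∀ m : ℕ, ∃ n, (m / (m + 1 : ℕ) : ℚ≥0) < ∑ k ∈ Finset.range n, M.haltProb k c := by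
  rw [le_antisymm_iff, and_iff_right (haltTotal_le_one hM c), one_le_iff_forall_natDivSucc_lt]
  simp only [lt_haltTotal_iff]

section PrimitiveRecursive

variable {S : Type*}

/-- One step of a finite weighted combination of configurations. -/
def spread (M : WeightedSystem S) (L : List (ℚ≥0 × S)) : List (ℚ≥0 × S) :=
  L.flatMap fun r => (M r.2).map fun s => (r.1 * s.1, s.2)

theorem sum_haltProb_spread (M : WeightedSystem S) (k : ℕ) (L : List (ℚ≥0 × S)) :
    ((M.spread L).map fun r => r.1 * M.haltProb k r.2).sum =
      (L.map fun r => r.1 * M.haltProb (k + 1) r.2).sum := by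
  induction L with
  | nil => rfl
  | cons r L ih =>
    rw [spread] at ih ⊢
    simp only [List.flatMap_cons, List.map_append, List.sum_append, ih, List.map_cons,
      List.sum_cons, haltProb, List.map_map, ← List.sum_map_mul_left, Function.comp_def, mul_assoc]

theorem sum_haltProb_iterate_spread (M : WeightedSystem S) (k : ℕ) (L : List (ℚ≥0 × S)) :
    (((M.spread)^[k] L).map fun r => r.1 * M.haltProb 0 r.2).sum =
      (L.map fun r => r.1 * M.haltProb k r.2).sum := by
  induction k generalizing L with
  | zero => rfl
  | succ k ih => rw [Function.iterate_succ_apply, ih, sum_haltProb_spread]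

variable [Primcodable S] {M : WeightedSystem S}

theorem primrec_spread (hM : Primrec M) : Primrec M.spread := by
  refine Primrec.list_flatMap Primrec.id ?_
  refine Primrec.list_map (hM.comp (Primrec.snd.comp Primrec.snd)) ?_
  exact (primrec_ratMul.comp (Primrec.fst.comp (Primrec.snd.comp Primrec.fst))
    (Primrec.fst.comp Primrec.snd)).pair (Primrec.snd.comp Primrec.snd)

theorem primrec_haltProb_zero (hM : Primrec M) : Primrec (M.haltProb 0) :=
  (Primrec.ite (Primrec.eq.comp (Primrec.list_length.comp hM) (Primrec.const 0))
    (Primrec.const 1) (Primrec.const 0)).of_eq fun c => by simp [haltProb]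

theorem primrec_haltProb (hM : Primrec M) : Primrec₂ M.haltProb := by
  have h : Primrec₂ fun (k : ℕ) (c : S) =>
      (((M.spread)^[k] [(1, c)]).map fun r => r.1 * M.haltProb 0 r.2).sum :=
    primrec_ratSum.comp (Primrec.list_map
      (Primrec.nat_iterate Primrec.fst (primrec_singleton.comp ((Primrec.const 1).pair Primrec.snd))
        ((primrec_spread hM).comp₂ Primrec₂.right))
      (primrec_ratMul.comp (Primrec.fst.comp Primrec.snd)
        ((primrec_haltProb_zero hM).comp (Primrec.snd.comp Primrec.snd))))
  exact h.of_eq fun k c => by simp [sum_haltProb_iterate_spread]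

theorem primrec_sum_haltProb (hM : Primrec M) :
    Primrec₂ fun (c : S) (n : ℕ) => ∑ k ∈ Finset.range n, M.haltProb k c :=
  primrec_ratSum.comp (Primrec.list_map (Primrec.list_range.comp Primrec.snd)
    ((primrec_haltProb hM).comp Primrec.snd (Primrec.fst.comp Primrec.fst)))

end PrimitiveRecursive

end WeightedSystem

/-! ## The small-step semantics as a weighted system -/

/-- The input `η` with the value of `v` changed to `q`. -/
def Input.update (η : Input) (v : Var) (q : ℚ≥0) : Input where
  val := Function.update η.val v q
  finite_support := (η.finite_support.insert v).subset fun u hu => by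
    by_cases h : u = v
    · exact Or.inl h
    · exact Or.inr (by simpa [Function.update_of_ne h] using hu)

@[simp] theorem Input.val_update (η : Input) (v : Var) (q : ℚ≥0) :
    (η.update v q).val = Function.update η.val v q := rfl

/-- A configuration of a stack machine for programs: a running program (or `none` if it has
terminated), the stack of programs to be run after it, and the current valuation. -/
abbrev Config := (Option Prog × List Prog) × Input

/-- The control component denoted by a running program and a stack. -/
def stackCtrl (c : Option Prog × List Prog) : Ctrl := c.2.foldl Ctrl.seq (c.1.elim .down .prog)

/-- The state denoted by a configuration, given the probability and the trace of the choices made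
so far. -/
def Config.toState (c : Config) (a : ℚ≥0) (θ : List Dir) : State := ⟨stackCtrl c.1, c.2.val, a, θ⟩

/-- Put `K` below the stack of a configuration. -/
def Config.push (K : List Prog) (c : Config) : Config := ((c.1.1, c.1.2 ++ K), c.2)

/-- The successors of a program, weighted by their probabilities. -/
def progSuccs (η : Input) : Prog → List (ℚ≥0 × Config)
  | .assign v e => [(1, (none, []), η.update v (max (e.eval η.val) 0).toNNRat)]
  | .seq P Q => (progSuccs η P).map (Prod.map id (Config.push [Q]))
  | .choice p P Q => [(p.1, (some P, []), η), (1 - p.1, (some Q, []), η)]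
  | .loop b P => if b.eval η.val then [(1, (some (.seq P (.loop b P)), []), η)]
      else [(1, (none, []), η)]

/-- The stack machine as a weighted system. -/
def succs : WeightedSystem Config
  | ((none, []), _) => []
  | ((none, Q :: K), η) => [(1, (some Q, K), η)]
  | ((some P, K), η) => (progSuccs η P).map (Prod.map id (Config.push K))

theorem Config.push_push (K K' : List Prog) (c : Config) :
    (c.push K).push K' = c.push (K ++ K') := by
  simp [push]

theorem Config.push_nil : Config.push [] = id := by
  funext c
  simp [push]

theorem stackCtrl_concat (o : Option Prog) (K : List Prog) (Q : Prog) :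
    stackCtrl (o, K ++ [Q]) = .seq (stackCtrl (o, K)) Q := by
  simp [stackCtrl]

theorem Config.toState_push (c : Config) (Q : Prog) (a : ℚ≥0) (θ : List Dir) :
    (c.push [Q]).toState a θ = ⟨.seq (c.toState a θ).ctrl Q, c.2.val, a, θ⟩ := by
  simp [push, toState, stackCtrl_concat]

theorem stackCtrl_eq_down_iff {c : Option Prog × List Prog} :
    stackCtrl c = .down ↔ c = (none, []) := by
  obtain ⟨o, K⟩ := c
  rcases List.eq_nil_or_concat K with rfl | ⟨K, Q, rfl⟩
  · cases o <;> simp [stackCtrl]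
  · simp [stackCtrl_concat]

theorem progSuccs_ne_nil (η : Input) (P : Prog) : progSuccs η P ≠ [] := by
  induction P with
  | loop b P => rw [progSuccs]; split <;> simp
  | _ => simp_all [progSuccs]

theorem succs_eq_nil_iff {c : Config} : succs c = [] ↔ c.1 = (none, []) := by
  obtain ⟨⟨_ | P, _ | ⟨Q, K⟩⟩, η⟩ := c <;> simp [succs, progSuccs_ne_nil]

theorem sum_progSuccs_fst (η : Input) (P : Prog) : ((progSuccs η P).map Prod.fst).sum = 1 := by
  induction P with
  | assign v e => simp [progSuccs]
  | seq P Q ih => simpa [progSuccs, Function.comp_def] using ih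
  | choice p P Q => simpa [progSuccs] using add_tsub_cancel_of_le p.2
  | loop b P => rw [progSuccs]; split <;> simp

theorem sum_succs_fst_le_one (c : Config) : ((succs c).map Prod.fst).sum ≤ 1 := by
  obtain ⟨⟨_ | P, _ | ⟨Q, K⟩⟩, η⟩ := c <;>
    simp [succs, Function.comp_def, sum_progSuccs_fst]

theorem tsum_list_bool (f : List Bool → ℝ≥0∞) :
    ∑' w, f w = f [] + (∑' w, f (true :: w) + ∑' w, f (false :: w)) := by
  let e : Unit ⊕ (Bool × List Bool) ≃ List Bool :=
    { toFun := fun o => o.elim (fun _ => []) fun x => x.1 :: x.2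
      invFun := fun w => match w with
        | [] => .inl ()
        | b :: w => .inr (b, w)
      left_inv := by rintro (_ | ⟨b, w⟩) <;> rfl
      right_inv := by rintro (_ | ⟨b, w⟩) <;> rfl }
  rw [← e.tsum_eq, Summable.tsum_sum ENNReal.summable ENNReal.summable, ENNReal.tsum_prod',
    tsum_bool, add_comm (∑' w, f (e (.inr (false, w)))), tsum_fintype]
  simp [e]

theorem tsum_nextProg {F : State → List Dir → ℝ≥0∞} {G : Config → ℚ≥0 → ℝ≥0∞}
    (hFG : ∀ c a θ, ∑' w, F (c.toState a θ) w = G c a) (η : Input) (P : Prog) (a : ℚ≥0)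
    (θ : List Dir) :
    ∑' w, (nextProg η.val a θ w P).elim 0 (fun r => F r.1 r.2) =
      ((progSuccs η P).map fun r => G r.2 (a * r.1)).sum := by
  induction P generalizing F G with
  | assign v e => simp [nextProg, progSuccs, ← hFG _ _ θ, Config.toState, stackCtrl]
  | seq P Q ih =>
    have := ih (F := fun σ w => F ⟨.seq σ.ctrl Q, σ.val, σ.prob, σ.trace⟩ w)
      (G := fun c a => G (c.push [Q]) a) fun c a θ => by rw [← hFG _ _ θ, Config.toState_push]; rfl
    simpa [nextProg, progSuccs, Option.elim_map, Function.comp_def] using this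
  | choice p P Q =>
    have left := hFG ((some P, []), η) (a * p.1) (θ ++ [Dir.L])
    have right := hFG ((some Q, []), η) (a * (1 - p.1)) (θ ++ [Dir.R])
    rw [tsum_list_bool]
    simp [nextProg, progSuccs, ← left, ← right, Config.toState, stackCtrl]
  | loop b P =>
    by_cases h : b.eval η.val <;>
      simp [nextProg, progSuccs, h, ← hFG _ _ θ, Config.toState, stackCtrl]

theorem succs_push {c : Config} (hc : c.1 ≠ (none, [])) (K : List Prog) :
    succs (c.push K) = (succs c).map (Prod.map id (Config.push K)) := by
  obtain ⟨⟨_ | P, _ | ⟨Q, K'⟩⟩, η⟩ := c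
  · exact absurd rfl hc
  · rfl
  all_goals simp [succs, Config.push, Function.comp_def]

theorem next_toState_push {c : Config} (hc : c.1 ≠ (none, [])) (Q : Prog) (a : ℚ≥0)
    (θ w : List Dir) :
    next ((c.push [Q]).toState a θ) w = (next (c.toState a θ) w).map fun r =>
      (⟨.seq r.1.ctrl Q, r.1.val, r.1.prob, r.1.trace⟩, r.2) := by
  rw [Config.toState_push]
  exact nextCtrl.eq_4 _ _ _ _ _ _ fun h => hc (stackCtrl_eq_down_iff.1 h)

theorem tsum_next {F : State → List Dir → ℝ≥0∞} {G : Config → ℚ≥0 → ℝ≥0∞}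
    (hFG : ∀ c a θ, ∑' w, F (c.toState a θ) w = G c a) (c : Config) (a : ℚ≥0) (θ : List Dir) :
    ∑' w, (next (c.toState a θ) w).elim 0 (fun r => F r.1 r.2) =
      ((succs c).map fun r => G r.2 (a * r.1)).sum := by
  obtain ⟨⟨o, K⟩, η⟩ := c
  induction K using List.reverseRecOn generalizing F G with
  | nil =>
    cases o with
    | none => simp [next, Config.toState, stackCtrl, nextCtrl, succs]
    | some P =>
      rw [succs, Config.push_nil, Prod.map_id, List.map_id]
      exact tsum_nextProg hFG η P a θ
  | append_singleton K Q ih =>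
    by_cases h : (o, K) = (none, [])
    · obtain ⟨rfl, rfl⟩ := Prod.mk.inj h
      simp [next, Config.toState, stackCtrl, nextCtrl, succs, ← hFG _ _ θ]
    · rw [show ((o, K ++ [Q]), η) = Config.push [Q] ((o, K), η) from rfl, succs_push h]
      simp only [next_toState_push (c := ((o, K), η)) h, Option.elim_map, List.map_map]
      exact ih (F := fun σ w => F ⟨.seq σ.ctrl Q, σ.val, σ.prob, σ.trace⟩ w)
        (G := fun c a => G (c.push [Q]) a)
          fun c a θ => by rw [← hFG _ _ θ, Config.toState_push]; rfl

theorem alpha_T_succ (k : ℕ) (σ : State) (w : List Dir) :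
    alpha (T (k + 1) σ w) = (next σ w).elim 0 fun r => alpha (T k r.1 r.2) := by
  rw [T]
  cases next σ w <;> rfl

theorem alpha_toState (c : Config) (a : ℚ≥0) (θ : List Dir) :
    alpha (some (c.toState a θ)) = a * succs.haltProb 0 c := by
  by_cases hc : c.1 = (none, [])
  · simp [WeightedSystem.haltProb, succs_eq_nil_iff.2 hc, Config.toState,
      stackCtrl_eq_down_iff.2 hc, alpha]
  · have hctrl : stackCtrl c.1 ≠ .down := fun h => hc (stackCtrl_eq_down_iff.1 h)
    have hzero : succs.haltProb 0 c = 0 := by simp [WeightedSystem.haltProb, succs_eq_nil_iff, hc]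
    rw [hzero, mul_zero, Config.toState]
    cases h : stackCtrl c.1 <;> first | rfl | exact absurd h hctrl

theorem tsum_alpha_T (k : ℕ) (c : Config) (a : ℚ≥0) (θ : List Dir) :
    ∑' w, ((alpha (T k (c.toState a θ) w) : ℝ≥0) : ℝ≥0∞) =
      ((a * succs.haltProb k c : ℚ≥0) : ℝ≥0) := by
  induction k generalizing c a θ with
  | zero =>
    rw [tsum_eq_single [] fun w hw => by simp [T, hw, alpha]]
    simp only [T, reduceIte, alpha_toState]
  | succ k ih =>
    have coe_sum (L : List (ℚ≥0 × Config)) :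
        (L.map fun r => (((a * r.1 * succs.haltProb k r.2 : ℚ≥0) : ℝ≥0) : ℝ≥0∞)).sum =
          ((a * (L.map fun r => r.1 * succs.haltProb k r.2).sum : ℚ≥0) : ℝ≥0) := by
      induction L with
      | nil => simp
      | cons r L ih => simp_all [mul_add, mul_assoc]
    rw [WeightedSystem.haltProb, ← coe_sum, ← tsum_next
      (F := fun σ w => ((alpha (T k σ w) : ℝ≥0) : ℝ≥0∞))
      (G := fun c a => (((a * succs.haltProb k c : ℚ≥0) : ℝ≥0) : ℝ≥0∞)) ih c a θ]
    refine tsum_congr fun w => ?_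
    rw [alpha_T_succ]
    cases next (c.toState a θ) w <;> simp

theorem Step.length_trace_le {σ τ : State} (h : Step σ τ) :
    τ.trace.length ≤ σ.trace.length + 1 := by
  induction h <;> simp_all

theorem T_eq_none_of_lt_length {k : ℕ} {σ : State} {w : List Dir} (h : k < w.length) :
    T k σ w = none := by
  induction k generalizing σ w with
  | zero => simp [T, List.ne_nil_of_length_pos h]
  | succ k ih =>
    rw [T]
    rcases hn : next σ w with _ | ⟨τ, w'⟩
    · rfl
    · obtain ⟨hστ, b, hb, rfl⟩ := next_eq_some_iff.1 hn
      have hlen := hστ.length_trace_le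
      simp only [hb, List.length_append] at hlen h
      exact ih (show k < w'.length by omega)

theorem prTerm_eq_haltTotal (P : Prog) (η : Input) :
    prTerm P η.val = succs.haltTotal ((some P, []), η) := by
  refine tsum_congr fun k => ?_
  have h := tsum_alpha_T k ((some P, []), η) 1 []
  rw [one_mul] at h
  rw [← h, ← (Equiv.sigmaFiberEquiv (List.length (α := Dir))).tsum_eq, ENNReal.tsum_sigma',
    tsum_eq_sum (s := Finset.range (k + 1))]
  · refine Finset.sum_congr rfl fun i _ => ?_
    exact (tsum_fintype (L := .unconditional _) fun w : List.Vector Dir i => _).symm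
  · intro i hi
    simp only [ENNReal.tsum_eq_zero]
    rintro ⟨w, rfl⟩
    rw [Equiv.sigmaFiberEquiv_apply, T_eq_none_of_lt_length (by simpa using hi)]
    simp [alpha]

/-! ## The small-step semantics is primitive recursive -/

instance : Primcodable AExp where
  encode := AExp.code
  decode n := some (AExp.ofCode n)
  encodek e := congrArg some e.ofCode_code
  prim := Nat.Primrec.succ.comp (Primrec.nat_iff.1 AExp.primrec_norm)

instance : Primcodable BExp where
  encode := BExp.code
  decode n := some (BExp.ofCode n)
  encodek b := congrArg some b.ofCode_code
  prim := Nat.Primrec.succ.comp (Primrec.nat_iff.1 BExp.primrec_norm)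

theorem AExp.primrec_code : Primrec AExp.code := Primrec.encode

theorem AExp.primrec_ofCode : Primrec AExp.ofCode := Primrec.encode_iff.1 AExp.primrec_norm

theorem BExp.primrec_code : Primrec BExp.code := Primrec.encode

theorem BExp.primrec_ofCode : Primrec BExp.ofCode := Primrec.encode_iff.1 BExp.primrec_norm

theorem Prog.primrec_code : Primrec Prog.code := Primrec.encode

theorem Prog.primrec_ofCode : Primrec Prog.ofCode := Primrec.encode_iff.1 Prog.primrec_norm

theorem primrec_probOfCode : Primrec fun n => (probOfCode n).1 :=
  Primrec.encode_iff.1 primrec_probNorm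

theorem primrec_inputList : Primrec inputList := Primrec.encode_iff.1 Primrec.encode

theorem primrec_inputOfList : Primrec inputOfList :=
  Primrec.encode_iff.1 (Primrec.encode.comp primrec_inputNorm :
    Primrec fun l => Encodable.encode (inputList (inputOfList l)))

section StructuralRecursion

variable {α σ : Type*} [Primcodable α] [Primcodable σ]

theorem primrecPred_ntag_eq (k : ℕ) : PrimrecPred fun x : α × ℕ × σ × σ => ntag x.2.1 = k :=
  Primrec.eq.comp (primrec_ntag.comp (Primrec.fst.comp Primrec.snd)) (Primrec.const k)

variable [Inhabited σ]

theorem primrec_treeRec {f : α → ℕ → σ} {G : α × ℕ × σ × σ → σ} (hG : Primrec G)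
    (hf : ∀ a n, f a n = G (a, n, if ntag n = 0 then default else f a (nfst n),
      if ntag n = 0 then default else f a (nsnd n))) : Primrec₂ f := by
  have hlen : Primrec fun x : α × List σ => x.2.length := Primrec.list_length.comp Primrec.snd
  have child {c : ℕ → ℕ} (hc : Primrec c) : Primrec fun x : α × List σ =>
      if ntag x.2.length = 0 then default else x.2.getD (c x.2.length) default :=
    Primrec.ite (Primrec.eq.comp (primrec_ntag.comp hlen) (Primrec.const 0)) (Primrec.const _)
      ((Primrec.list_getD _).comp Primrec.snd (hc.comp hlen))
  refine Primrec.nat_strong_rec _ (g := fun a l => some (G (a, l.length,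
      if ntag l.length = 0 then default else l.getD (nfst l.length) default,
      if ntag l.length = 0 then default else l.getD (nsnd l.length) default)))
    (Primrec.option_some.comp (hG.comp (Primrec.fst.pair
      (hlen.pair ((child primrec_nfst).pair (child primrec_nsnd)))))) fun a n => ?_
  simp only [List.length_map, List.length_range]
  rw [hf a n]
  by_cases h : ntag n = 0
  · simp [h]
  · simp [h, List.getD, nfst_lt h, nsnd_lt h]

theorem AExp.primrec_rec {f : α → AExp → σ} {fconst : α → ℚ≥0 → σ} {fvar : α → Var → σ}
    {fadd fsub fmul : α → σ × σ → σ} (hconst : Primrec₂ fconst) (hvar : Primrec₂ fvar)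
    (hadd : Primrec₂ fadd) (hsub : Primrec₂ fsub) (hmul : Primrec₂ fmul)
    (f_const : ∀ a q, f a (.const q) = fconst a q) (f_var : ∀ a v, f a (.var v) = fvar a v)
    (f_add : ∀ a e₁ e₂, f a (.add e₁ e₂) = fadd a (f a e₁, f a e₂))
    (f_sub : ∀ a e₁ e₂, f a (.sub e₁ e₂) = fsub a (f a e₁, f a e₂))
    (f_mul : ∀ a e₁ e₂, f a (.mul e₁ e₂) = fmul a (f a e₁, f a e₂)) : Primrec₂ f := by
  have ha : Primrec fun x : α × ℕ × σ × σ => x.1 := Primrec.fst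
  have hl : Primrec fun x : α × ℕ × σ × σ => nlab x.2.1 :=
    primrec_nlab.comp (Primrec.fst.comp Primrec.snd)
  have hs : Primrec fun x : α × ℕ × σ × σ => x.2.2 := Primrec.snd.comp Primrec.snd
  have hcode : Primrec₂ fun a n => f a (ofCode n) := by
    refine primrec_treeRec
      (Primrec.ite (primrecPred_ntag_eq 0) (hconst.comp ha (primrec_ratOfCode.comp hl))
        (Primrec.ite (primrecPred_ntag_eq 1) (hvar.comp ha hl)
          (Primrec.ite (primrecPred_ntag_eq 2) (hadd.comp ha hs)
            (Primrec.ite (primrecPred_ntag_eq 3) (hsub.comp ha hs) (hmul.comp ha hs)))))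
      fun a n => ?_
    rw [ofCode]
    split_ifs <;> simp_all
  exact (hcode.comp₂ Primrec₂.left (primrec_code.comp₂ Primrec₂.right)).of_eq fun a e => by
    rw [ofCode_code]

theorem BExp.primrec_rec {f : α → BExp → σ} {feq flt : α → AExp × AExp → σ} {fnot : α → σ → σ}
    {fand : α → σ × σ → σ} (heq : Primrec₂ feq) (hlt : Primrec₂ flt) (hnot : Primrec₂ fnot)
    (hand : Primrec₂ fand) (f_eq : ∀ a e₁ e₂, f a (.eq e₁ e₂) = feq a (e₁, e₂))
    (f_lt : ∀ a e₁ e₂, f a (.lt e₁ e₂) = flt a (e₁, e₂))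
    (f_not : ∀ a b, f a (.not b) = fnot a (f a b))
    (f_and : ∀ a b₁ b₂, f a (.and b₁ b₂) = fand a (f a b₁, f a b₂)) : Primrec₂ f := by
  have ha : Primrec fun x : α × ℕ × σ × σ => x.1 := Primrec.fst
  have hl : Primrec fun x : α × ℕ × σ × σ => (nlab x.2.1).unpair :=
    Primrec.unpair.comp (primrec_nlab.comp (Primrec.fst.comp Primrec.snd))
  have he : Primrec fun x : α × ℕ × σ × σ =>
      (AExp.ofCode (nlab x.2.1).unpair.1, AExp.ofCode (nlab x.2.1).unpair.2) :=
    (AExp.primrec_ofCode.comp (Primrec.fst.comp hl)).pair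
      (AExp.primrec_ofCode.comp (Primrec.snd.comp hl))
  have hs : Primrec fun x : α × ℕ × σ × σ => x.2.2 := Primrec.snd.comp Primrec.snd
  have hcode : Primrec₂ fun a n => f a (ofCode n) := by
    refine primrec_treeRec
      (Primrec.ite (primrecPred_ntag_eq 0) (heq.comp ha he)
        (Primrec.ite (primrecPred_ntag_eq 1) (hlt.comp ha he)
          (Primrec.ite (primrecPred_ntag_eq 2) (hnot.comp ha (Primrec.fst.comp hs))
            (hand.comp ha hs)))) fun a n => ?_
    rw [ofCode]
    split_ifs <;> simp_all
  exact (hcode.comp₂ Primrec₂.left (primrec_code.comp₂ Primrec₂.right)).of_eq fun a b => by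
    rw [ofCode_code]

theorem Prog.primrec_rec {f : α → Prog → σ} {fassign : α → Var × AExp → σ}
    {fseq : α → (Prog × Prog) × σ × σ → σ} {fchoice : α → ℚ≥0 × (Prog × Prog) × σ × σ → σ}
    {floop : α → BExp × Prog × σ → σ} (hassign : Primrec₂ fassign) (hseq : Primrec₂ fseq)
    (hchoice : Primrec₂ fchoice) (hloop : Primrec₂ floop)
    (f_assign : ∀ a v e, f a (.assign v e) = fassign a (v, e))
    (f_seq : ∀ a P Q, f a (.seq P Q) = fseq a ((P, Q), f a P, f a Q))
    (f_choice : ∀ a p P Q, f a (.choice p P Q) = fchoice a (p.1, (P, Q), f a P, f a Q))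
    (f_loop : ∀ a b P, f a (.loop b P) = floop a (b, P, f a P)) : Primrec₂ f := by
  have ha : Primrec fun x : α × ℕ × σ × σ => x.1 := Primrec.fst
  have hn : Primrec fun x : α × ℕ × σ × σ => x.2.1 := Primrec.fst.comp Primrec.snd
  have hl : Primrec fun x : α × ℕ × σ × σ => nlab x.2.1 := primrec_nlab.comp hn
  have hs : Primrec fun x : α × ℕ × σ × σ => x.2.2 := Primrec.snd.comp Primrec.snd
  have hP : Primrec fun x : α × ℕ × σ × σ => ofCode (nfst x.2.1) :=
    primrec_ofCode.comp (primrec_nfst.comp hn)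
  have hQ : Primrec fun x : α × ℕ × σ × σ => ofCode (nsnd x.2.1) :=
    primrec_ofCode.comp (primrec_nsnd.comp hn)
  have hve : Primrec fun x : α × ℕ × σ × σ =>
      ((nlab x.2.1).unpair.1, AExp.ofCode (nlab x.2.1).unpair.2) :=
    (Primrec.fst.comp (Primrec.unpair.comp hl)).pair
      (AExp.primrec_ofCode.comp (Primrec.snd.comp (Primrec.unpair.comp hl)))
  have hcode : Primrec₂ fun a n => f a (ofCode n) := by
    refine primrec_treeRec
      (Primrec.ite (primrecPred_ntag_eq 0) (hassign.comp ha hve)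
        (Primrec.ite (primrecPred_ntag_eq 1) (hseq.comp ha ((hP.pair hQ).pair hs))
          (Primrec.ite (primrecPred_ntag_eq 2)
            (hchoice.comp ha ((primrec_probOfCode.comp hl).pair ((hP.pair hQ).pair hs)))
            (hloop.comp ha ((BExp.primrec_ofCode.comp hl).pair (hP.pair (Primrec.fst.comp hs)))))))
      fun a n => ?_
    rw [ofCode]
    split_ifs <;> simp_all
  exact (hcode.comp₂ Primrec₂.left (primrec_code.comp₂ Primrec₂.right)).of_eq fun a P => by
    rw [ofCode_code]

end StructuralRecursion

theorem Prog.primrec_seq : Primrec₂ Prog.seq :=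
  (primrec_ofCode.comp (primrec_node (Primrec.const 1) (Primrec.const 0)
    (primrec_code.comp Primrec.fst) (primrec_code.comp Primrec.snd))).of_eq
    fun x => ofCode_code (.seq x.1 x.2)

theorem Prog.primrec_loop : Primrec₂ Prog.loop :=
  (primrec_ofCode.comp (primrec_node (Primrec.const 3) (BExp.primrec_code.comp Primrec.fst)
    (primrec_code.comp Primrec.snd) (Primrec.const 0))).of_eq
    fun x => ofCode_code (.loop x.1 x.2)

theorem Input.ext_val {η ζ : Input} (h : η.val = ζ.val) : η = ζ := by
  cases η
  cases ζ
  congr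

theorem val_inputOfList (l : List ℕ) (v : Var) : (inputOfList l).val v = ratOfCode (l.getD v 0) :=
  rfl

theorem val_eq_inputList (η : Input) (v : Var) :
    η.val v = ratOfCode ((inputList η).getD v 0) := by
  rw [← val_inputOfList, inputOfList_inputList]

theorem primrec_val : Primrec₂ Input.val :=
  (primrec_ratOfCode.comp₂ ((Primrec.list_getD 0).comp₂
    (primrec_inputList.comp₂ Primrec₂.left) Primrec₂.right)).of_eq fun η v =>
      (val_eq_inputList η v).symm

/-- Set the entry at index `v` of the zero-extension of `l` to `m`. -/
def listUpdate (l : List ℕ) (v m : ℕ) : List ℕ :=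
  (List.range (l.length + (v + 1))).map fun u => if u = v then m else l.getD u 0

theorem getD_listUpdate (l : List ℕ) (v m u : ℕ) :
    (listUpdate l v m).getD u 0 = if u = v then m else l.getD u 0 := by
  by_cases hu : u < l.length + (v + 1)
  · simp [listUpdate, List.getD, List.getElem?_range hu]
  · have hv : u ≠ v := by omega
    have hl : l.length ≤ u := by omega
    rw [List.getD_eq_default _ _ (by simpa [listUpdate] using hu), if_neg hv,
      List.getD_eq_default _ _ hl]

theorem primrec_listUpdate : Primrec fun x : List ℕ × ℕ × ℕ => listUpdate x.1 x.2.1 x.2.2 :=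
  Primrec.list_map
    (Primrec.list_range.comp (Primrec.nat_add.comp (Primrec.list_length.comp Primrec.fst)
      (Primrec.succ.comp (Primrec.fst.comp Primrec.snd))))
    (Primrec.ite (Primrec.eq.comp Primrec.snd (Primrec.fst.comp (Primrec.snd.comp Primrec.fst)))
      (Primrec.snd.comp (Primrec.snd.comp Primrec.fst))
      ((Primrec.list_getD 0).comp (Primrec.fst.comp Primrec.fst) Primrec.snd))

theorem inputOfList_listUpdate (η : Input) (v : Var) (q : ℚ≥0) :
    inputOfList (listUpdate (inputList η) v (ratCode q)) = η.update v q := by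
  refine Input.ext_val (funext fun u => ?_)
  rw [val_inputOfList, getD_listUpdate, Input.val_update, Function.update_apply,
    apply_ite ratOfCode, ratOfCode_ratCode, ← val_eq_inputList]

theorem primrec_update : Primrec fun x : Input × Var × ℚ≥0 => x.1.update x.2.1 x.2.2 :=
  (primrec_inputOfList.comp (primrec_listUpdate.comp ((primrec_inputList.comp Primrec.fst).pair
    ((Primrec.fst.comp Primrec.snd).pair
      (primrec_ratCode.comp (Primrec.snd.comp Primrec.snd)))))).of_eq fun x =>
        inputOfList_listUpdate x.1 x.2.1 x.2.2

/-- The value of an expression, represented as a formal difference of nonnegative rationals. -/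
def AExp.evalPair (η : Input) : AExp → ℚ≥0 × ℚ≥0
  | .const q => (q, 0)
  | .var v => (η.val v, 0)
  | .add e₁ e₂ => e₁.evalPair η + e₂.evalPair η
  | .sub e₁ e₂ => e₁.evalPair η + (e₂.evalPair η).swap
  | .mul e₁ e₂ =>
      ((e₁.evalPair η).1 * (e₂.evalPair η).1 + (e₁.evalPair η).2 * (e₂.evalPair η).2,
        (e₁.evalPair η).1 * (e₂.evalPair η).2 + (e₁.evalPair η).2 * (e₂.evalPair η).1)

theorem AExp.eval_eq_evalPair (η : Input) (e : AExp) :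
    e.eval η.val = ((e.evalPair η).1 : ℚ) - (e.evalPair η).2 := by
  induction e with
  | const q => simp [eval, evalPair]
  | var v => simp [eval, evalPair]
  | add e₁ e₂ ih₁ ih₂ | sub e₁ e₂ ih₁ ih₂ | mul e₁ e₂ ih₁ ih₂ =>
    simp only [eval, evalPair, ih₁, ih₂, Prod.fst_add, Prod.snd_add, Prod.fst_swap, Prod.snd_swap]
    push_cast
    ring

theorem AExp.toNNRat_eval (η : Input) (e : AExp) :
    (max (e.eval η.val) 0).toNNRat = (e.evalPair η).1 - (e.evalPair η).2 := by
  rw [NNRat.toNNRat_mono.map_max, Rat.toNNRat_zero, max_zero, eval_eq_evalPair, NNRat.sub_def]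

theorem AExp.eval_eq_eval_iff (η : Input) (e₁ e₂ : AExp) : e₁.eval η.val = e₂.eval η.val ↔
    (e₁.evalPair η).1 + (e₂.evalPair η).2 = (e₂.evalPair η).1 + (e₁.evalPair η).2 := by
  rw [eval_eq_evalPair, eval_eq_evalPair, sub_eq_sub_iff_add_eq_add]
  norm_cast

theorem AExp.eval_lt_eval_iff (η : Input) (e₁ e₂ : AExp) : e₁.eval η.val < e₂.eval η.val ↔
    (e₁.evalPair η).1 + (e₂.evalPair η).2 < (e₂.evalPair η).1 + (e₁.evalPair η).2 := by
  rw [eval_eq_evalPair, eval_eq_evalPair, sub_lt_sub_iff]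
  norm_cast

theorem AExp.primrec_evalPair : Primrec₂ AExp.evalPair := by
  let Pairs := Input × (ℚ≥0 × ℚ≥0) × ℚ≥0 × ℚ≥0
  have h₁₁ : Primrec fun x : Pairs => x.2.1.1 := Primrec.fst.comp (Primrec.fst.comp Primrec.snd)
  have h₁₂ : Primrec fun x : Pairs => x.2.1.2 := Primrec.snd.comp (Primrec.fst.comp Primrec.snd)
  have h₂₁ : Primrec fun x : Pairs => x.2.2.1 := Primrec.fst.comp (Primrec.snd.comp Primrec.snd)
  have h₂₂ : Primrec fun x : Pairs => x.2.2.2 := Primrec.snd.comp (Primrec.snd.comp Primrec.snd)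
  have hadd : Primrec₂ fun (_ : Input) (x : (ℚ≥0 × ℚ≥0) × ℚ≥0 × ℚ≥0) => x.1 + x.2 :=
    (primrec_ratAdd.comp h₁₁ h₂₁).pair (primrec_ratAdd.comp h₁₂ h₂₂)
  have hsub : Primrec₂ fun (_ : Input) (x : (ℚ≥0 × ℚ≥0) × ℚ≥0 × ℚ≥0) => x.1 + x.2.swap :=
    (primrec_ratAdd.comp h₁₁ h₂₂).pair (primrec_ratAdd.comp h₁₂ h₂₁)
  have hmul : Primrec₂ fun (_ : Input) (x : (ℚ≥0 × ℚ≥0) × ℚ≥0 × ℚ≥0) =>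
      (x.1.1 * x.2.1 + x.1.2 * x.2.2, x.1.1 * x.2.2 + x.1.2 * x.2.1) :=
    (primrec_ratAdd.comp (primrec_ratMul.comp h₁₁ h₂₁) (primrec_ratMul.comp h₁₂ h₂₂)).pair
      (primrec_ratAdd.comp (primrec_ratMul.comp h₁₁ h₂₂) (primrec_ratMul.comp h₁₂ h₂₁))
  have hconst : Primrec₂ fun (_ : Input) (q : ℚ≥0) => (q, (0 : ℚ≥0)) :=
    Primrec.snd.pair (Primrec.const 0)
  have hvar : Primrec₂ fun (η : Input) (v : Var) => (η.val v, (0 : ℚ≥0)) :=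
    Primrec.pair primrec_val (Primrec.const 0)
  exact primrec_rec hconst hvar hadd hsub hmul
    (fun _ _ => rfl) (fun _ _ => rfl) (fun _ _ _ => rfl) (fun _ _ _ => rfl) fun _ _ _ => rfl

theorem BExp.primrec_eval : Primrec₂ fun (η : Input) (b : BExp) => b.eval η.val := by
  have hcross : Primrec₂ fun (η : Input) (e : AExp × AExp) =>
      (e.1.evalPair η).1 + (e.2.evalPair η).2 :=
    primrec_ratAdd.comp
      (Primrec.fst.comp (AExp.primrec_evalPair.comp Primrec.fst (Primrec.fst.comp Primrec.snd)))
      (Primrec.snd.comp (AExp.primrec_evalPair.comp Primrec.fst (Primrec.snd.comp Primrec.snd)))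
  have hcross' : Primrec₂ fun (η : Input) (e : AExp × AExp) =>
      (e.2.evalPair η).1 + (e.1.evalPair η).2 :=
    hcross.comp Primrec.fst ((Primrec.snd.comp Primrec.snd).pair (Primrec.fst.comp Primrec.snd))
  exact primrec_rec (f := fun η b => b.eval η.val) (Primrec.eq.comp₂ hcross hcross').decide
    (primrec_ratLt.comp₂ hcross hcross').decide
    (Primrec.not.comp₂ Primrec₂.right) (Primrec.and.comp₂ (Primrec.fst.comp₂ Primrec₂.right)
      (Primrec.snd.comp₂ Primrec₂.right))
    (fun η e₁ e₂ => decide_eq_decide.2 (AExp.eval_eq_eval_iff η e₁ e₂))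
    (fun η e₁ e₂ => decide_eq_decide.2 (AExp.eval_lt_eval_iff η e₁ e₂))
    (fun _ _ => rfl) fun _ _ _ => rfl

theorem primrec_push : Primrec₂ Config.push :=
  Primrec.pair
    (Primrec.pair (Primrec.fst.comp (Primrec.fst.comp Primrec.snd))
      (Primrec.list_append.comp (Primrec.snd.comp (Primrec.fst.comp Primrec.snd)) Primrec.fst))
    (Primrec.snd.comp Primrec.snd)

theorem primrec_map_push {α : Type*} [Primcodable α] {L : α → List (ℚ≥0 × Config)}
    {K : α → List Prog} (hL : Primrec L) (hK : Primrec K) :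
    Primrec fun a => (L a).map (Prod.map id (Config.push (K a))) :=
  Primrec.list_map hL ((Primrec.fst.comp Primrec.snd).pair
    (primrec_push.comp (hK.comp Primrec.fst) (Primrec.snd.comp Primrec.snd)))

theorem primrec_weightedProg {α : Type*} [Primcodable α] {q : α → ℚ≥0} {P : α → Prog}
    {η : α → Input} (hq : Primrec q) (hP : Primrec P) (hη : Primrec η) :
    Primrec fun a => ((q a, (some (P a), []), η a) : ℚ≥0 × Config) :=
  hq.pair (((Primrec.option_some.comp hP).pair (Primrec.const [])).pair hη)

theorem primrec_weightedDown {α : Type*} [Primcodable α] {η : α → Input} (hη : Primrec η) :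
    Primrec fun a => [((1, (none, []), η a) : ℚ≥0 × Config)] :=
  primrec_singleton.comp ((Primrec.const 1).pair ((Primrec.const (none, [])).pair hη))

theorem primrec_progSuccs_assign : Primrec₂ fun (η : Input) (x : Var × AExp) =>
    progSuccs η (.assign x.1 x.2) := by
  have he : Primrec fun x : Input × Var × AExp => x.2.2.evalPair x.1 :=
    AExp.primrec_evalPair.comp Primrec.fst (Primrec.snd.comp Primrec.snd)
  refine (primrec_weightedDown (primrec_update.comp (Primrec.fst.pair
    ((Primrec.fst.comp Primrec.snd).pair
      (primrec_ratSub.comp (Primrec.fst.comp he) (Primrec.snd.comp he)))))).of_eq ?_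
  rintro ⟨η, v, e⟩
  simp only [progSuccs, AExp.toNNRat_eval]

theorem primrec_progSuccs_loop : Primrec₂ fun (η : Input) (x : BExp × Prog) =>
    progSuccs η (.loop x.1 x.2) := by
  have hb : Primrec fun x : Input × BExp × Prog => x.2.1 := Primrec.fst.comp Primrec.snd
  have hP : Primrec fun x : Input × BExp × Prog => x.2.2 := Primrec.snd.comp Primrec.snd
  exact Primrec.ite
    (Primrec.eq.comp (BExp.primrec_eval.comp Primrec.fst hb) (Primrec.const true))
    (primrec_singleton.comp (primrec_weightedProg (Primrec.const 1)
      (Prog.primrec_seq.comp hP (Prog.primrec_loop.comp hb hP)) Primrec.fst))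
    (primrec_weightedDown Primrec.fst)

theorem primrec_progSuccs : Primrec₂ progSuccs := by
  let L := List (ℚ≥0 × Config)
  have hseq : Primrec₂ fun (_ : Input) (x : (Prog × Prog) × L × L) =>
      x.2.1.map (Prod.map id (Config.push [x.1.2])) :=
    primrec_map_push (Primrec.fst.comp (Primrec.snd.comp Primrec.snd))
      (primrec_singleton.comp (Primrec.snd.comp (Primrec.fst.comp Primrec.snd)))
  have hp : Primrec fun x : Input × ℚ≥0 × (Prog × Prog) × L × L => x.2.1 :=
    Primrec.fst.comp Primrec.snd
  have hPQ : Primrec fun x : Input × ℚ≥0 × (Prog × Prog) × L × L => x.2.2.1 :=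
    Primrec.fst.comp (Primrec.snd.comp Primrec.snd)
  have hchoice : Primrec₂ fun (η : Input) (x : ℚ≥0 × (Prog × Prog) × L × L) =>
      ([(x.1, (some x.2.1.1, []), η), (1 - x.1, (some x.2.1.2, []), η)] : L) :=
    Primrec.list_cons.comp (primrec_weightedProg hp (Primrec.fst.comp hPQ) Primrec.fst)
      (primrec_singleton.comp (primrec_weightedProg
        (primrec_ratSub.comp (Primrec.const 1) hp) (Primrec.snd.comp hPQ) Primrec.fst))
  have hloop : Primrec₂ fun (η : Input) (x : BExp × Prog × L) =>
      progSuccs η (.loop x.1 x.2.1) :=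
    primrec_progSuccs_loop.comp Primrec.fst ((Primrec.fst.comp Primrec.snd).pair
      (Primrec.fst.comp (Primrec.snd.comp Primrec.snd)))
  exact Prog.primrec_rec primrec_progSuccs_assign hseq hchoice hloop
    (fun _ _ _ => rfl) (fun _ _ _ => rfl) (fun _ _ _ _ => rfl) fun _ _ _ => rfl

theorem primrec_succs : Primrec succs := by
  have hK : Primrec fun c : Config => c.1.2 := Primrec.snd.comp Primrec.fst
  have hpop : Primrec fun c : Config => (List.casesOn c.1.2 []
      fun Q K => [(1, (some Q, K), c.2)] : List (ℚ≥0 × Config)) :=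
    Primrec.list_casesOn hK (Primrec.const []) (h := fun c x => [(1, (some x.1, x.2), c.2)])
      (primrec_singleton.comp ((Primrec.const 1).pair
        (((Primrec.option_some.comp (Primrec.fst.comp Primrec.snd)).pair
          (Primrec.snd.comp Primrec.snd)).pair (Primrec.snd.comp Primrec.fst))))
  refine (Primrec.option_casesOn (Primrec.fst.comp Primrec.fst) hpop
    (g := fun c P => (progSuccs c.2 P).map (Prod.map id (Config.push c.1.2)))
    (primrec_map_push (primrec_progSuccs.comp (Primrec.snd.comp Primrec.fst) Primrec.snd)
      (hK.comp Primrec.fst))).of_eq ?_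
  rintro ⟨⟨_ | P, _ | ⟨Q, K⟩⟩, η⟩ <;> rfl

theorem isPi2_AST : IsPi2 AST := by
  refine ⟨fun x => (x.2.1 / (x.2.1 + 1 : ℕ) : ℚ≥0) <
    ∑ k ∈ Finset.range x.2.2, succs.haltProb k ((some x.1.1, []), x.1.2), ?_, fun x => ?_⟩
  · have hy₁ : Primrec fun x : (Prog × Input) × ℕ × ℕ => x.2.1 := Primrec.fst.comp Primrec.snd
    have hc : Primrec fun x : (Prog × Input) × ℕ × ℕ => (((some x.1.1, []), x.1.2) : Config) :=
      ((Primrec.option_some.comp (Primrec.fst.comp Primrec.fst)).pair (Primrec.const [])).pair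
        (Primrec.snd.comp Primrec.fst)
    exact (primrec_ratLt.comp (primrec_natDivSucc.comp hy₁ hy₁)
      ((WeightedSystem.primrec_sum_haltProb primrec_succs).comp hc
        (Primrec.snd.comp Primrec.snd))).computablePred
  · rw [AST, Set.mem_ofPred_eq, prTerm_eq_haltTotal,
      WeightedSystem.haltTotal_eq_one_iff sum_succs_fst_le_one]

/-! ## Programs for the primitive recursive functions -/

/-- `P` runs deterministically from `η` to termination in `η'`, whatever is to be run next. -/
def Exec (P : Prog) (η η' : Input) : Prop :=
  ∀ K, Relation.TransGen succs.DetStep ((some P, K), η) ((none, K), η')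

theorem exec_of_progSuccs {P : Prog} {η η' : Input} (h : progSuccs η P = [(1, (none, []), η')]) :
    Exec P η η' := fun K =>
  .single (by simp [WeightedSystem.DetStep, succs, h, Config.push])

theorem succs_seq (P Q : Prog) (K : List Prog) (η : Input) :
    succs ((some (.seq P Q), K), η) = succs ((some P, Q :: K), η) := by
  simp [succs, progSuccs, Config.push_push, Function.comp_def]

theorem Exec.transGen_seq {P Q : Prog} {η η' : Input} (h : Exec P η η') (K : List Prog) :
    Relation.TransGen succs.DetStep ((some (.seq P Q), K), η) ((some Q, K), η') := by
  obtain ⟨c, hPc, hcQ⟩ := Relation.TransGen.head'_iff.1 ((h (Q :: K)).tail rfl)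
  exact .head' ((succs_seq P Q K η).trans hPc) hcQ

theorem Exec.seq {P Q : Prog} {η η' η'' : Input} (h₁ : Exec P η η') (h₂ : Exec Q η' η'') :
    Exec (.seq P Q) η η'' := fun K =>
  (h₁.transGen_seq K).trans (h₂ K)

theorem exec_loop_of_false {b : BExp} {P : Prog} {η : Input} (h : b.eval η.val = false) :
    Exec (.loop b P) η η :=
  exec_of_progSuccs (by simp [progSuccs, h])

theorem detStep_loop {b : BExp} {η : Input} (h : b.eval η.val = true) (P : Prog) (K : List Prog) :
    succs.DetStep ((some (.loop b P), K), η) ((some (.seq P (.loop b P)), K), η) := by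
  simp [WeightedSystem.DetStep, succs, progSuccs, h, Config.push]

theorem exec_loop_of_true {b : BExp} {P : Prog} {η η' η'' : Input} (h : b.eval η.val = true)
    (h₁ : Exec P η η') (h₂ : Exec (.loop b P) η' η'') : Exec (.loop b P) η η'' := fun K =>
  .head (detStep_loop h P K) (h₁.seq h₂ K)

/-- `P` runs deterministically from `η` to termination with postcondition `R`. -/
def Reaches (P : Prog) (η : Input) (R : Input → Prop) : Prop := ∃ η', Exec P η η' ∧ R η'

theorem Reaches.mono {P : Prog} {η : Input} {R R' : Input → Prop} (h : Reaches P η R)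
    (hR : ∀ η', R η' → R' η') : Reaches P η R' :=
  h.imp fun η' h => ⟨h.1, hR η' h.2⟩

theorem reaches_seq {P Q : Prog} {η : Input} {R : Input → Prop}
    (h : Reaches P η fun η' => Reaches Q η' R) : Reaches (.seq P Q) η R := by
  obtain ⟨η', h₁, η'', h₂, hR⟩ := h
  exact ⟨η'', h₁.seq h₂, hR⟩

theorem reaches_assign {v : Var} {e : AExp} {η : Input} {R : Input → Prop} {m : ℕ}
    (h : e.eval η.val = m) (hR : R (η.update v m)) : Reaches (.assign v e) η R := by
  refine ⟨_, exec_of_progSuccs rfl, ?_⟩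
  rwa [h, max_eq_left m.cast_nonneg, NNRat.toNNRat_coe_nat]

theorem reaches_assign_var {u v : Var} {η : Input} {R : Input → Prop} {m : ℕ} (h : η.val u = m)
    (hR : R (η.update v m)) : Reaches (.assign v (.var u)) η R :=
  reaches_assign (by simp [AExp.eval, h]) hR

theorem reaches_loop {b : BExp} {P : Prog} {R : Input → Prop} (I : ℕ → Input → Prop)
    (h₀ : ∀ η, I 0 η → b.eval η.val = false ∧ R η)
    (h₁ : ∀ k η, I (k + 1) η → b.eval η.val = true ∧ Reaches P η (I k)) {k : ℕ} {η : Input}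
    (h : I k η) : Reaches (.loop b P) η R := by
  induction k generalizing η with
  | zero => exact ⟨η, exec_loop_of_false (h₀ η h).1, (h₀ η h).2⟩
  | succ k ih =>
    obtain ⟨hb, η', hP, hI⟩ := h₁ k η h
    obtain ⟨η'', hL, hR⟩ := ih hI
    exact ⟨η'', exec_loop_of_true hb hP hL, hR⟩

/-- The valuation `η` stores the vector `v` in the variables `x`. -/
def Stores {n : ℕ} (η : Input) (x : Fin n → Var) (v : List.Vector ℕ n) : Prop :=
  ∀ i, η.val (x i) = v.get i

/-- `P` computes the function `f` from the variables `x` to the variable `b`, without changing any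
variable below `b`. -/
def Computes {n : ℕ} (x : Fin n → Var) (b : Var) (P : Prog) (f : List.Vector ℕ n → ℕ) : Prop :=
  ∀ η v, Stores η x v →
    Reaches P η fun η' => η'.val b = f v ∧ Set.EqOn η'.val η.val (Set.Iio b)

/-- The function `f` can be computed by a program, from any variables to any larger one. -/
def ProgComputable {n : ℕ} (f : List.Vector ℕ n → ℕ) : Prop :=
  ∀ (x : Fin n → Var) (b : Var), (∀ i, x i < b) → ∃ P, Computes x b P f

theorem Input.eqOn_update (η : Input) (v : Var) (q : ℚ≥0) {s : Set Var} (hv : v ∉ s) :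
    Set.EqOn (η.update v q).val η.val s := fun _ hu =>
  Function.update_of_ne (ne_of_mem_of_not_mem hu hv) _ _

theorem Stores.of_eqOn {n : ℕ} {η η' : Input} {x : Fin n → Var} {v : List.Vector ℕ n} {b : Var}
    (h : Stores η x v) (hx : ∀ i, x i < b) (hη : Set.EqOn η'.val η.val (Set.Iio b)) :
    Stores η' x v := fun i =>
  (hη (hx i)).trans (h i)

theorem Stores.cons {n : ℕ} {η : Input} {x : Fin n → Var} {v : List.Vector ℕ n} {y : Var} {a : ℕ}
    (hy : η.val y = a) (h : Stores η x v) : Stores η (Fin.cons y x) (a ::ᵥ v) := by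
  intro i
  cases i using Fin.cases <;> simp [hy, h _]

theorem computes_assign {n : ℕ} {x : Fin n → Var} {b : Var} {e : AExp} {f : List.Vector ℕ n → ℕ}
    (h : ∀ η v, Stores η x v → e.eval η.val = f v) : Computes x b (.assign b e) f := by
  intro η v hv
  exact reaches_assign (h η v hv) ⟨by simp, η.eqOn_update b _ Set.self_notMem_Iio⟩

theorem progComputable_zero : ProgComputable fun _ : List.Vector ℕ 0 => 0 := fun _ b _ =>
  ⟨.assign b (.const 0), computes_assign fun _ _ _ => by simp [AExp.eval]⟩

theorem progComputable_succ : ProgComputable fun v : List.Vector ℕ 1 => v.head.succ := fun x b _ =>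
  ⟨.assign b (.add (.var (x 0)) (.const 1)),
    computes_assign fun _ _ hv => by simp [AExp.eval, hv 0]⟩

theorem progComputable_get {n : ℕ} (i : Fin n) :
    ProgComputable fun v : List.Vector ℕ n => v.get i := fun x b _ =>
  ⟨.assign b (.var (x i)), computes_assign fun _ _ hv => by simp [AExp.eval, hv i]⟩

theorem exists_reaches_stores_ofFn {m n : ℕ} {g : Fin n → List.Vector ℕ m → ℕ}
    (hg : ∀ i, ProgComputable (g i)) {x : Fin m → Var} {b : Var} (hx : ∀ i, x i < b) :
    ∃ P, ∀ η v, Stores η x v → Reaches P η fun η' =>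
      Stores η' (fun i : Fin n => b + i) (List.Vector.ofFn fun i => g i v) ∧
        Set.EqOn η'.val η.val (Set.Iio b) := by
  induction n with
  | zero =>
    refine ⟨.assign b (.const 0), fun η v _ => reaches_assign (m := 0) (by simp [AExp.eval]) ?_⟩
    exact ⟨fun i => i.elim0, η.eqOn_update b _ Set.self_notMem_Iio⟩
  | succ n ih =>
    obtain ⟨P, hP⟩ := ih fun i => hg i.castSucc
    obtain ⟨Q, hQ⟩ := hg (Fin.last n) x (b + n) fun i => Nat.lt_add_right n (hx i)
    refine ⟨.seq P Q, fun η v hv => reaches_seq ((hP η v hv).mono ?_)⟩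
    rintro η' ⟨hinit, hη'⟩
    refine (hQ η' v (hv.of_eqOn hx hη')).mono ?_
    rintro η'' ⟨hlast, hη''⟩
    refine ⟨fun i => ?_, (hη''.mono (Set.Iio_subset_Iio (Nat.le_add_right b n))).trans hη'⟩
    cases i using Fin.lastCases with
    | last => simpa using hlast
    | cast i => simpa using (hη'' (Nat.add_lt_add_left i.2 b)).trans (hinit i)

theorem ProgComputable.comp {m n : ℕ} {f : List.Vector ℕ n → ℕ} {g : Fin n → List.Vector ℕ m → ℕ}
    (hf : ProgComputable f) (hg : ∀ i, ProgComputable (g i)) :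
    ProgComputable fun v => f (List.Vector.ofFn fun i => g i v) := by
  intro x b hx
  obtain ⟨P, hP⟩ := exists_reaches_stores_ofFn hg hx
  obtain ⟨Q, hQ⟩ := hf (fun i => b + i) (b + n) fun i => Nat.add_lt_add_left i.2 b
  refine ⟨.seq P (.seq Q (.assign b (.var (b + n)))), fun η v hv =>
    reaches_seq ((hP η v hv).mono ?_)⟩
  rintro η' ⟨hargs, hη'⟩
  refine reaches_seq ((hQ η' _ hargs).mono ?_)
  rintro η'' ⟨hval, hη''⟩
  refine reaches_assign_var hval ⟨by simp, ?_⟩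
  exact (η''.eqOn_update b _ Set.self_notMem_Iio).trans
    ((hη''.mono (Set.Iio_subset_Iio (Nat.le_add_right b n))).trans hη')

/-- The body of the loop for primitive recursion, where `b` holds the value computed so far, `b + 1`
the number of past iterations, and `P` computes the next value in `b + 2`. -/
def precBody (b : Var) (P : Prog) : Prog :=
  .seq P (.seq (.assign b (.var (b + 2))) (.assign (b + 1) (.add (.var (b + 1)) (.const 1))))

theorem reaches_precBody {n : ℕ} {g : List.Vector ℕ (n + 2) → ℕ} {x : Fin n → Var} {b : Var}
    {P : Prog} (hP : Computes (Fin.cons (b + 1) (Fin.cons b x)) (b + 2) P g) {η : Input} {y a : ℕ}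
    {v : List.Vector ℕ n} (hb : η.val b = a) (hy : η.val (b + 1) = y) (hv : Stores η x v) :
    Reaches (precBody b P) η fun η' => η'.val b = g (y ::ᵥ a ::ᵥ v) ∧
      η'.val (b + 1) = (y + 1 : ℕ) ∧ Set.EqOn η'.val η.val (Set.Iio b) := by
  refine reaches_seq ((hP η _ ((hv.cons hb).cons hy)).mono ?_)
  rintro η₁ ⟨hval, hη₁⟩
  have hy₁ : η₁.val (b + 1) = y := (hη₁ (Nat.lt_succ_self (b + 1))).trans hy
  refine reaches_seq (reaches_assign_var hval
    (reaches_assign (m := y + 1) (by simp [AExp.eval, hy₁]) ⟨by simp, by simp, ?_⟩))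
  exact (Input.eqOn_update _ (b + 1) _ (by simp)).trans
    ((η₁.eqOn_update b _ Set.self_notMem_Iio).trans
      (hη₁.mono (Set.Iio_subset_Iio (Nat.le_add_right b 2))))

theorem reaches_precLoop {n : ℕ} {g : List.Vector ℕ (n + 2) → ℕ} {x : Fin n → Var} {b u : Var}
    {P : Prog} (hP : Computes (Fin.cons (b + 1) (Fin.cons b x)) (b + 2) P g) (hx : ∀ i, x i < b)
    (hub : u < b) {η : Input} {m a : ℕ} {v : List.Vector ℕ n} (hu : η.val u = m) (hb : η.val b = a)
    (hy : η.val (b + 1) = 0) (hv : Stores η x v) :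
    Reaches (.loop (.lt (.var (b + 1)) (.var u)) (precBody b P)) η fun η' =>
      η'.val b = (m.rec a fun y IH => g (y ::ᵥ IH ::ᵥ v) : ℕ) ∧
        Set.EqOn η'.val η.val (Set.Iio b) := by
  let I (k : ℕ) (η' : Input) : Prop :=
    ∃ y, y + k = m ∧ η'.val b = (y.rec a fun y IH => g (y ::ᵥ IH ::ᵥ v) : ℕ) ∧
      η'.val (b + 1) = y ∧ Set.EqOn η'.val η.val (Set.Iio b)
  have eval_guard {η' : Input} {y : ℕ} (hy : η'.val (b + 1) = y)
      (hη' : Set.EqOn η'.val η.val (Set.Iio b)) :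
      (BExp.lt (.var (b + 1)) (.var u)).eval η'.val = decide (y < m) := by
    simp [BExp.eval, AExp.eval, hy, hη' hub, hu]
  refine reaches_loop I ?_ ?_ (k := m) ⟨0, zero_add m, hb, by simpa using hy, Set.eqOn_refl _ _⟩
  · rintro η' ⟨y, rfl, hb', hy', hη'⟩
    exact ⟨by simp [eval_guard hy' hη'], hb', hη'⟩
  · rintro k η' ⟨y, rfl, hb', hy', hη'⟩
    refine ⟨by simp [eval_guard hy' hη'],
      (reaches_precBody hP hb' hy' (hv.of_eqOn hx hη')).mono ?_⟩
    rintro η'' ⟨hb'', hy'', hη''⟩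
    exact ⟨y + 1, by omega, hb'', hy'', hη''.trans hη'⟩

theorem ProgComputable.prec {n : ℕ} {f : List.Vector ℕ n → ℕ} {g : List.Vector ℕ (n + 2) → ℕ}
    (hf : ProgComputable f) (hg : ProgComputable g) :
    ProgComputable fun v : List.Vector ℕ (n + 1) =>
      v.head.rec (f v.tail) fun y IH => g (y ::ᵥ IH ::ᵥ v.tail) := by
  intro x b hx
  obtain ⟨P, hP⟩ := hf (Fin.tail x) b fun i => hx i.succ
  obtain ⟨Q, hQ⟩ := hg (Fin.cons (b + 1) (Fin.cons b (Fin.tail x))) (b + 2) fun i => by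
    cases i using Fin.cases with
    | zero => simp
    | succ i => cases i using Fin.cases with
      | zero => simp
      | succ i => exact Nat.lt_add_right 2 (hx i.succ)
  refine ⟨.seq P (.seq (.assign (b + 1) (.const 0))
    (.loop (.lt (.var (b + 1)) (.var (x 0))) (precBody b Q))), fun η v hv => ?_⟩
  have htail : Stores η (Fin.tail x) v.tail := fun i => by simpa [Fin.tail] using hv i.succ
  refine reaches_seq ((hP η _ htail).mono ?_)
  rintro η₁ ⟨hval, hη₁⟩
  have hη₁' : Set.EqOn (η₁.update (b + 1) (0 : ℕ)).val η.val (Set.Iio b) :=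
    (η₁.eqOn_update (b + 1) _ (by simp)).trans hη₁
  refine reaches_seq (reaches_assign (m := 0) (by simp [AExp.eval]) ?_)
  refine (reaches_precLoop hQ (fun i => hx i.succ) (hx 0) (m := v.head) (a := f v.tail) ?_ ?_ ?_
    (htail.of_eqOn (fun i => hx i.succ) hη₁')).mono fun η₂ ⟨hval₂, hη₂⟩ =>
      ⟨hval₂, hη₂.trans hη₁'⟩
  · simpa using (hη₁' (hx 0)).trans (hv 0)
  · simpa using hval
  · simp

theorem progComputable_of_primrec' {n : ℕ} {f : List.Vector ℕ n → ℕ} (hf : Nat.Primrec' f) :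
    ProgComputable f := by
  induction hf with
  | zero => exact progComputable_zero
  | succ => exact progComputable_succ
  | get i => exact progComputable_get i
  | comp g _ _ hf hg => exact hf.comp hg
  | prec _ _ hf hg => exact hf.prec hg

/-! ## Hardness -/

theorem exists_primrec_of_computablePred {α : Type*} [Primcodable α] {R : α → Prop}
    (hR : ComputablePred R) :
    ∃ h : ℕ → ℕ → ℕ, Primrec₂ h ∧ ∀ x, R x ↔ ∃ k, h (Encodable.encode x) k = 0 := by
  obtain ⟨_, hR⟩ := hR
  obtain ⟨c, hc⟩ := Nat.Partrec.Code.exists_code.1 hR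
  have iff_evaln (x : α) : R x ↔ ∃ k, c.evaln k (Encodable.encode x) = some 1 := by
    have : R x ↔ 1 ∈ c.eval (Encodable.encode x) := by by_cases hx : R x <;> simp [hc, hx]
    rw [this, Nat.Partrec.Code.evaln_complete]
    rfl
  refine ⟨fun n k => if c.evaln k n = some 1 then 0 else 1, ?_, fun x => by simp [iff_evaln]⟩
  exact Primrec.ite (Primrec.eq.comp (Nat.Partrec.Code.primrec_evaln.comp
    ((Primrec.snd.pair (Primrec.const c)).pair Primrec.fst)) (Primrec.const (some 1)))
    (Primrec.const 0) (Primrec.const 1)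

theorem exists_primrec_of_isPi2 {α : Type} [Primcodable α] {C : Set α} (hC : IsPi2 C) :
    ∃ h : ℕ → ℕ → ℕ → ℕ, (Primrec fun x : ℕ × ℕ × ℕ => h x.1 x.2.1 x.2.2) ∧
      ∀ x, x ∈ C ↔ ∀ y, ∃ z, h (Encodable.encode x) y z = 0 := by
  obtain ⟨R, hR, hCR⟩ := hC
  obtain ⟨h, hprim, hiff⟩ := exists_primrec_of_computablePred hR
  refine ⟨fun n y z => h (Nat.pair n (Nat.pair y z.unpair.1)) z.unpair.2, ?_, fun x => ?_⟩
  · have hz : Primrec fun x : ℕ × ℕ × ℕ => x.2.2.unpair :=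
      Primrec.unpair.comp (Primrec.snd.comp Primrec.snd)
    exact hprim.comp (Primrec₂.natPair.comp Primrec.fst (Primrec₂.natPair.comp
      (Primrec.fst.comp Primrec.snd) (Primrec.fst.comp hz))) (Primrec.snd.comp hz)
  · rw [hCR]
    refine forall_congr' fun y => ⟨fun ⟨z, hz⟩ => ?_, fun ⟨z, hz⟩ => ?_⟩
    · obtain ⟨k, hk⟩ := (hiff _).1 hz
      exact ⟨Nat.pair z k, by simpa using hk⟩
    · exact ⟨z.unpair.1, (hiff _).2 ⟨z.unpair.2, by simpa using hz⟩⟩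

/-- `H` stores `h v₀ v₁ v₃` in `v₄`. -/
def Tests (H : Prog) (h : ℕ → ℕ → ℕ → ℕ) : Prop :=
  Computes ![0, 1, 3] 4 H fun v => h (v.get 0) (v.get 1) (v.get 2)

/-- The test program `H` for the next value of `v₃`. -/
def searchStep (H : Prog) : Prog := .seq (.assign 3 (.add (.var 3) (.const 1))) H

/-- Apply `searchStep H` until `v₄ = 0`. -/
def searchLoop (H : Prog) : Prog := .loop (.not (.eq (.var 4) (.const 0))) (searchStep H)

/-- Apply the test program `H` for `v₃ = 0, 1, …` until it sets `v₄` to `0`. -/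
def searchProg (H : Prog) : Prog := .seq (.seq (.assign 3 (.const 0)) H) (searchLoop H)

/-- The fair coin. -/
def half : Prob := ⟨2⁻¹, by norm_num⟩

/-- With equal probabilities, set the exit flag `v₂` or go on to the next value of `v₁`. -/
def exitOrNext : Prog :=
  .choice half (.assign 2 (.const 1)) (.assign 1 (.add (.var 1) (.const 1)))

/-- Run `searchProg H` for successive values of `v₁`, stopping with probability one half after each
successful search. -/
def hardProg (H : Prog) : Prog :=
  .loop (.eq (.var 2) (.const 0)) (.seq (searchProg H) exitOrNext)

/-- The valuations in which `hardProg` starts the search for `y`, on an instance coded by `X`. -/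
def AtRound (X y : ℕ) (η : Input) : Prop := η.val 0 = X ∧ η.val 1 = y ∧ η.val 2 = 0

/-- The valuations in which `hardProg`, while searching for `y`, has just tested `z`. -/
def Searching (h : ℕ → ℕ → ℕ → ℕ) (X y z : ℕ) (η : Input) : Prop :=
  AtRound X y η ∧ η.val 3 = z ∧ η.val 4 = h X y z

theorem AtRound.of_eqOn {X y : ℕ} {η η' : Input} (hη : AtRound X y η)
    (h : Set.EqOn η'.val η.val (Set.Iio 3)) : AtRound X y η' :=
  ⟨(h (by simp)).trans hη.1, (h (by simp)).trans hη.2.1, (h (by simp)).trans hη.2.2⟩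

theorem Exec.haltTotal_eq {P : Prog} {η η' : Input} (h : Exec P η η') (Q : Prog) (K : List Prog) :
    succs.haltTotal ((some P, Q :: K), η) = succs.haltTotal ((some Q, K), η') :=
  WeightedSystem.haltTotal_eq_of_transGen ((h (Q :: K)).tail rfl)

theorem Exec.haltTotal_eq_one {P : Prog} {η η' : Input} (h : Exec P η η') :
    succs.haltTotal ((some P, []), η) = 1 :=
  (WeightedSystem.haltTotal_eq_of_transGen (h [])).trans (WeightedSystem.haltTotal_of_eq_nil rfl)

theorem haltTotal_seq (P Q : Prog) (K : List Prog) (η : Input) :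
    succs.haltTotal ((some (.seq P Q), K), η) = succs.haltTotal ((some P, Q :: K), η) :=
  WeightedSystem.haltTotal_congr (succs_seq P Q K η)

theorem haltTotal_choice_half (P Q : Prog) (K : List Prog) (η : Input) :
    succs.haltTotal ((some (.choice half P Q), K), η) =
      2⁻¹ * succs.haltTotal ((some P, K), η) + 2⁻¹ * succs.haltTotal ((some Q, K), η) := by
  have hsucc : succs ((some (.choice half P Q), K), η) =
      [(2⁻¹, ((some P, K), η)), (2⁻¹, ((some Q, K), η))] := by
    have : (1 - 2⁻¹ : ℚ≥0) = 2⁻¹ := tsub_eq_of_eq_add (by norm_num)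
    simp [succs, progSuccs, half, Config.push, this]
  simpa using WeightedSystem.haltTotal_of_eq_pair hsucc

section

variable {H : Prog} {h : ℕ → ℕ → ℕ → ℕ} {X y z : ℕ} {η : Input}

theorem Searching.eval_guard (hη : Searching h X y z η) :
    (BExp.not (.eq (.var 4) (.const 0))).eval η.val = decide (h X y z ≠ 0) := by
  simp [BExp.eval, AExp.eval, hη.2.2]

theorem AtRound.reaches_searching {e : AExp} (hη : AtRound X y η) (he : e.eval η.val = z)
    (hH : Tests H h) :
    Reaches (.seq (.assign 3 e) H) η (Searching h X y z) := by
  refine reaches_seq (reaches_assign he ?_)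
  have hη' : AtRound X y (η.update 3 z) := hη.of_eqOn (η.eqOn_update 3 _ Set.self_notMem_Iio)
  have hargs : Stores (η.update 3 z) ![0, 1, 3] (X ::ᵥ y ::ᵥ z ::ᵥ .nil) := by
    intro i
    fin_cases i
    exacts [hη'.1, hη'.2.1, by simp; rfl]
  refine (hH _ _ hargs).mono fun η'' ⟨hval, hη''⟩ => ?_
  exact ⟨hη'.of_eqOn (hη''.mono (Set.Iio_subset_Iio (by decide))),
    (hη'' (by simp)).trans (by simp), hval⟩

theorem Searching.reaches_searchStep (hη : Searching h X y z η)
    (hH : Tests H h) :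
    Reaches (searchStep H) η (Searching h X y (z + 1)) :=
  hη.1.reaches_searching (by simp [AExp.eval, hη.2.1]) hH

theorem AtRound.reaches_searchProg (hη : AtRound X y η)
    (hH : Tests H h)
    (hz : ∃ z, h X y z = 0) : Reaches (searchProg H) η (AtRound X y) := by
  refine reaches_seq
    ((hη.reaches_searching (z := 0) (by simp [AExp.eval]) hH).mono fun η₁ hη₁ => ?_)
  refine reaches_loop (fun k ζ => ∃ z, z + k = Nat.find hz ∧ Searching h X y z ζ) ?_ ?_
    ⟨0, zero_add _, hη₁⟩
  · rintro ζ ⟨z, rfl, hζ⟩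
    exact ⟨by simpa [hζ.eval_guard] using Nat.find_spec hz, hζ.1⟩
  · rintro k ζ ⟨z, hzk, hζ⟩
    refine ⟨?_, (hζ.reaches_searchStep hH).mono fun ζ' hζ' => ⟨z + 1, by omega, hζ'⟩⟩
    simpa [hζ.eval_guard] using Nat.find_min hz (m := z) (by omega)

theorem Searching.haltTotal_eq_zero (hη : Searching h X y z η)
    (hH : Tests H h)
    (hz : ∀ z, h X y z ≠ 0) (K : List Prog) :
    succs.haltTotal ((some (searchLoop H), K), η) = 0 := by
  refine WeightedSystem.haltTotal_eq_zero_of_forall_transGen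
    (A := {c | ∃ ζ z, Searching h X y z ζ ∧ c = ((some (searchLoop H), K), ζ)}) ?_ ⟨η, z, hη, rfl⟩
  rintro _ ⟨ζ, z, hζ, rfl⟩
  obtain ⟨ζ', hexec, hζ'⟩ := hζ.reaches_searchStep hH
  exact ⟨_, ⟨ζ', z + 1, hζ', rfl⟩,
    .head (detStep_loop (by simp [hζ.eval_guard, hz]) _ _) (hexec.transGen_seq K)⟩

theorem AtRound.haltTotal_hardProg_eq (hη : AtRound X y η) :
    succs.haltTotal ((some (hardProg H), []), η) =
      succs.haltTotal ((some (searchProg H), [exitOrNext, hardProg H]), η) := by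
  have hguard : (BExp.eq (.var 2) (.const 0)).eval η.val = true := by
    simp [BExp.eval, AExp.eval, hη.2.2]
  rw [hardProg, (detStep_loop hguard _ []).haltTotal_eq, haltTotal_seq, haltTotal_seq]

theorem AtRound.haltTotal_hardProg_eq_zero (hη : AtRound X y η) (hH : Tests H h)
    (hz : ∀ z, h X y z ≠ 0) : succs.haltTotal ((some (hardProg H), []), η) = 0 := by
  obtain ⟨η', hexec, hη'⟩ :=
    hη.reaches_searching (e := .const 0) (z := 0) (by simp [AExp.eval]) hH
  rw [hη.haltTotal_hardProg_eq, searchProg, haltTotal_seq, hexec.haltTotal_eq,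
    hη'.haltTotal_eq_zero hH hz]

theorem AtRound.exists_haltTotal_hardProg_eq (hη : AtRound X y η) (hH : Tests H h)
    (hz : ∃ z, h X y z = 0) :
    ∃ η', AtRound X (y + 1) η' ∧ succs.haltTotal ((some (hardProg H), []), η) =
      2⁻¹ + 2⁻¹ * succs.haltTotal ((some (hardProg H), []), η') := by
  obtain ⟨η₁, hsearch, hη₁⟩ := hη.reaches_searchProg hH hz
  obtain ⟨η₂, hexit, hη₂⟩ : Reaches (.assign 2 (.const 1)) η₁ fun η' => η'.val 2 = 1 :=
    reaches_assign (m := 1) (by simp [AExp.eval]) (by simp)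
  obtain ⟨η₃, hnext, hη₃⟩ : Reaches (.assign 1 (.add (.var 1) (.const 1))) η₁ (AtRound X (y + 1)) :=
    reaches_assign (m := y + 1) (by simp [AExp.eval, hη₁.2.1])
      ⟨by simp [hη₁.1], by simp, by simp [hη₁.2.2]⟩
  have hdone : Exec (hardProg H) η₂ η₂ :=
    exec_loop_of_false (by simp [BExp.eval, AExp.eval, hη₂])
  refine ⟨η₃, hη₃, ?_⟩
  rw [hη.haltTotal_hardProg_eq, hsearch.haltTotal_eq, exitOrNext, haltTotal_choice_half,
    hexit.haltTotal_eq, hdone.haltTotal_eq_one, hnext.haltTotal_eq, mul_one]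

theorem AtRound.haltTotal_hardProg_eq_one (hη : AtRound X y η) (hH : Tests H h)
    (hz : ∀ y, ∃ z, h X y z = 0) : succs.haltTotal ((some (hardProg H), []), η) = 1 := by
  refine le_antisymm (WeightedSystem.haltTotal_le_one sum_succs_fst_le_one _)
    (one_le_of_forall_exists_mix_le (A := {ζ | ∃ y, AtRound X y ζ}) (p := 2⁻¹) (q := 2⁻¹)
      (F := fun ζ => succs.haltTotal ((some (hardProg H), []), ζ)) (by simp)
      ENNReal.inv_two_add_inv_two ?_ ⟨y, hη⟩)
  rintro ζ ⟨y, hζ⟩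
  obtain ⟨ζ', hζ', heq⟩ := hζ.exists_haltTotal_hardProg_eq hH (hz y)
  exact ⟨ζ', ⟨y + 1, hζ'⟩, heq.ge⟩

theorem AtRound.haltTotal_hardProg_lt_one {n : ℕ} (hη : AtRound X y η) (hH : Tests H h)
    (hz : ∀ z, h X (y + n) z ≠ 0) : succs.haltTotal ((some (hardProg H), []), η) < 1 := by
  induction n generalizing y η with
  | zero => simp [hη.haltTotal_hardProg_eq_zero hH hz]
  | succ n ih =>
    by_cases hzy : ∃ z, h X y z = 0
    · obtain ⟨η', hη', heq⟩ := hη.exists_haltTotal_hardProg_eq hH hzy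
      have hlt := ih hη' (by rwa [add_right_comm])
      calc _ = 2⁻¹ + 2⁻¹ * succs.haltTotal ((some (hardProg H), []), η') := heq
        _ < 2⁻¹ + 2⁻¹ * 1 := ENNReal.add_lt_add_left (by simp)
          (ENNReal.mul_lt_mul_right (by simp) (by simp) hlt)
        _ = 1 := by rw [mul_one, ENNReal.inv_two_add_inv_two]
    · simp [hη.haltTotal_hardProg_eq_zero hH (not_exists.1 hzy)]

end

/-- The input with the value `n` of `v₀`, all other variables being `0`. -/
def natInput (n : ℕ) : Input := inputOfList [Nat.pair n 0]

theorem atRound_natInput (n : ℕ) : AtRound n 0 (natInput n) := by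
  simp [AtRound, natInput, inputOfList, ratOfCode]

theorem primrec_natInput : Primrec natInput :=
  primrec_inputOfList.comp (primrec_singleton.comp
    (Primrec₂.natPair.comp Primrec.id (Primrec.const 0)))

theorem exists_tests {h : ℕ → ℕ → ℕ → ℕ} (hh : Primrec fun x : ℕ × ℕ × ℕ => h x.1 x.2.1 x.2.2) :
    ∃ H, Tests H h := by
  have get (i : Fin 3) : Primrec fun v : List.Vector ℕ 3 => v.get i :=
    Primrec.vector_get.comp Primrec.id (Primrec.const i)
  exact progComputable_of_primrec' (Nat.Primrec'.of_prim
    (hh.comp ((get 0).pair ((get 1).pair (get 2))))) _ _ (by decide)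

theorem manyOneReducible_AST {α : Type} [Primcodable α] {C : Set α} (hC : IsPi2 C) :
    (· ∈ C) ≤₀ (· ∈ AST) := by
  obtain ⟨h, hprim, hiff⟩ := exists_primrec_of_isPi2 hC
  obtain ⟨H, hH⟩ := exists_tests hprim
  refine ⟨fun x => (hardProg H, natInput (Encodable.encode x)),
    ((Primrec.const _).pair (primrec_natInput.comp Primrec.encode)).to_comp, fun x => ?_⟩
  have hη := atRound_natInput (Encodable.encode x)
  change x ∈ C ↔ prTerm _ _ = 1
  rw [hiff, prTerm_eq_haltTotal]
  refine ⟨hη.haltTotal_hardProg_eq_one hH, fun hone => ?_⟩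
  by_contra! ⟨n, hn⟩
  exact (hη.haltTotal_hardProg_lt_one hH (n := n) (by rwa [zero_add])).ne hone

end PGCL

theorem mainTheorem1 : IsPi2Complete PGCL.AST :=
  ⟨PGCL.isPi2_AST, fun _ _ _ => PGCL.manyOneReducible_AST⟩
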